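/- Let $\mathbb K$ be a field and let $C$ be a finite dimensional $\mathbb K$-algebra of global dimension at most two (for instance, of global dimension exactly two). Write $\operatorname{mod} C$ for the category of finitely generated left $C$-modules, $D=\operatorname{Hom}_{\mathbb K}(-,\mathbb K)$, and $\nu = D\operatorname{Hom}_C(-,C)\cong DC\otimes_C -$ for the Nakayama functor on $\operatorname{mod} C$; its left derived functor on $D^b(\operatorname{mod} C)$ is also denoted by $\nu$, and $\tau=\nu[-1]$. Let $\tau^{-1}=\nu^{-1}[1]$ with $\nu^{-1}=\mathbf R\operatorname{Hom}_C(DC,-)$, and $F=\tau^{-1}[1]$. Assume that $C=C_0\oplus C_R$ as a left $C$-module, with $\operatorname{Hom}_C(C_R,C_0)=0$ and $\operatorname{Ext}^1_C(\nu C_R,C_0)=0$. Then: 1. $FC_0$ is, up to isomorphism, the unique object $X$ of $D^b(\operatorname{mod} C)$ with $\nu X\cong C_0[2]$ (that is, with $\tau X\cong C_0[1]$); 2. $T=FC_0\oplus C_R$ is a tilting complex in $D^b(\operatorname{mod} C)$: $T$ is isomorphic to a bounded complex of finitely generated projective modules, $\operatorname{Hom}_{D^b(\operatorname{mod} C)}(T,T[n])=0$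 for every integer $n\neq 0$, and the smallest thick triangulated subcategory containing $T$ contains every bounded complex of finitely generated projective modules. The complex $T$ is called the (generalized) $2$-APR tilting complex associated to $C_0$. -/

import Mathlib

open CategoryTheory CategoryTheory.Limits

universe w u

namespace TwoAPR

/-! ### Left modules over a finite dimensional algebra: duals, the Nakayama functor

Throughout, `C` is an algebra over a field `K`, modules are left modules, `mod C` is
`FGModuleCat C`, and `D = Hom_K(-, K)`. -/

section Modules

variable (K : Type u) [Field K] (C : Type u) [Ring C] [Algebra K C]

/-- Right multiplication by `c : C` on `Hom_C(M, C)`, namely `(φ c)(m) = φ(m) c`. -/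
def homRightMul (M : Type u) [AddCommGroup M] [Module C M] (c : C) :
    (M →ₗ[C] C) →ₗ[K] (M →ₗ[C] C) where
  toFun φ := LinearMap.toSpanSingleton C C c ∘ₗ φ
  map_add' φ ψ := by ext m; simp [add_mul]
  map_smul' a φ := by ext m; simp

/-- The underlying space `D Hom_C(M, C)` of the left `C`-module `ν M`. -/
def NakayamaObj (M : Type u) [AddCommGroup M] [Module C M] : Type u :=
  Module.Dual K (M →ₗ[C] C)

instance (M : Type u) [AddCommGroup M] [Module C M] : AddCommGroup (NakayamaObj K C M) :=
  inferInstanceAs (AddCommGroup (Module.Dual K (M →ₗ[C] C)))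

instance (M : Type u) [AddCommGroup M] [Module C M] : Module K (NakayamaObj K C M) :=
  inferInstanceAs (Module K (Module.Dual K (M →ₗ[C] C)))

/-- The left action of `C` on `D Hom_C(M, C)`: `(c • ξ)(φ) = ξ(φ c)`. -/
instance (M : Type u) [AddCommGroup M] [Module C M] : Module C (NakayamaObj K C M) where
  smul c ξ := LinearMap.comp (σ₁₂ := RingHom.id K) (σ₂₃ := RingHom.id K)
    (show Module.Dual K (M →ₗ[C] C) from ξ) (homRightMul K C M c)
  one_smul ξ := by
    refine LinearMap.ext fun φ => ?_
    change (show Module.Dual K (M →ₗ[C] C) from ξ) _ = _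
    congr 1; ext m; simp [homRightMul]
  mul_smul c d ξ := by
    refine LinearMap.ext fun φ => ?_
    change (show Module.Dual K (M →ₗ[C] C) from ξ) _ =
      (show Module.Dual K (M →ₗ[C] C) from ξ) _
    congr 1; ext m; simp [homRightMul, mul_assoc]
  smul_zero c := rfl
  smul_add c ξ η := rfl
  add_smul c d ξ := by
    refine LinearMap.ext fun φ => ?_
    change (show Module.Dual K (M →ₗ[C] C) from ξ) _ =
      (show Module.Dual K (M →ₗ[C] C) from ξ) _ + (show Module.Dual K (M →ₗ[C] C) from ξ) _
    rw [← map_add]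
    congr 1; ext m; simp [homRightMul, mul_add]
  zero_smul ξ := by
    refine LinearMap.ext fun φ => ?_
    change (show Module.Dual K (M →ₗ[C] C) from ξ) _ = 0
    rw [← map_zero (show Module.Dual K (M →ₗ[C] C) from ξ)]
    congr 1; ext m; simp [homRightMul]

lemma NakayamaObj.smul_apply {M : Type u} [AddCommGroup M] [Module C M] (c : C)
    (ξ : NakayamaObj K C M) (φ : M →ₗ[C] C) :
    (show Module.Dual K (M →ₗ[C] C) from c • ξ) φ =
      (show Module.Dual K (M →ₗ[C] C) from ξ) (homRightMul K C M c φ) := rfl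

instance (M : Type u) [AddCommGroup M] [Module C M] :
    IsScalarTower K C (NakayamaObj K C M) where
  smul_assoc a c ξ := by
    refine LinearMap.ext fun φ => ?_
    change (show Module.Dual K (M →ₗ[C] C) from ξ) _ =
      a • (show Module.Dual K (M →ₗ[C] C) from ξ) _
    rw [← map_smul]
    congr 1; ext m; simp [homRightMul]

/-- The underlying space of the left `C`-module `DC = Hom_K(C, K)`. -/
def DualRegular : Type u := Module.Dual K C

instance : AddCommGroup (DualRegular K C) := inferInstanceAs (AddCommGroup (Module.Dual K C))

instance : Module K (DualRegular K C) := inferInstanceAs (Module K (Module.Dual K C))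

/-- The left action of `C` on `DC`: `(c • f)(x) = f(x c)`. -/
instance : Module C (DualRegular K C) where
  smul c f := LinearMap.comp (σ₁₂ := RingHom.id K) (σ₂₃ := RingHom.id K)
    (show Module.Dual K C from f) (LinearMap.mulRight K c)
  one_smul f := by
    refine LinearMap.ext fun x => ?_
    change (show Module.Dual K C from f) (x * 1) = _
    rw [mul_one]
  mul_smul c d f := by
    refine LinearMap.ext fun x => ?_
    change (show Module.Dual K C from f) (x * (c * d)) =
      (show Module.Dual K C from f) (x * c * d)
    rw [mul_assoc]
  smul_zero c := rfl
  smul_add c f g := rfl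
  add_smul c d f := by
    refine LinearMap.ext fun x => ?_
    change (show Module.Dual K C from f) (x * (c + d)) =
      (show Module.Dual K C from f) (x * c) + (show Module.Dual K C from f) (x * d)
    rw [mul_add, map_add]
  zero_smul f := by
    refine LinearMap.ext fun x => ?_
    change (show Module.Dual K C from f) (x * 0) = 0
    rw [mul_zero, map_zero]

instance : IsScalarTower K C (DualRegular K C) where
  smul_assoc a c f := by
    refine LinearMap.ext fun x => ?_
    change (show Module.Dual K C from f) (x * (a • c)) =
      a • (show Module.Dual K C from f) (x * c)
    rw [mul_smul_comm, map_smul]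

/-- Right multiplication by `c : C` on `DC`: `(f c)(x) = f(c x)`. -/
def dualRightMul (c : C) : DualRegular K C →ₗ[C] DualRegular K C where
  toFun f := LinearMap.comp (σ₁₂ := RingHom.id K) (σ₂₃ := RingHom.id K)
    (show Module.Dual K C from f) (LinearMap.mulLeft K c)
  map_add' f g := rfl
  map_smul' d f := by
    refine LinearMap.ext fun x => ?_
    change (show Module.Dual K C from f) (c * x * d) =
      (show Module.Dual K C from f) (c * (x * d))
    rw [mul_assoc]

/-- The underlying space `Hom_C(DC, M)` of the value of the inverse Nakayama functor at `M`. -/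
def InvNakayamaObj (M : Type u) [AddCommGroup M] [Module C M] : Type u :=
  DualRegular K C →ₗ[C] M

instance (M : Type u) [AddCommGroup M] [Module C M] : AddCommGroup (InvNakayamaObj K C M) :=
  inferInstanceAs (AddCommGroup (DualRegular K C →ₗ[C] M))

/-- The left action of `C` on `Hom_C(DC, M)`: `(c • φ)(f) = φ(f c)`. -/
instance (M : Type u) [AddCommGroup M] [Module C M] : Module C (InvNakayamaObj K C M) where
  smul c φ := LinearMap.comp (σ₁₂ := RingHom.id C) (σ₂₃ := RingHom.id C)
    (show DualRegular K C →ₗ[C] M from φ) (dualRightMul K C c)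
  one_smul φ := by
    refine LinearMap.ext fun f => ?_
    change (show DualRegular K C →ₗ[C] M from φ) _ = _
    congr 1
    refine LinearMap.ext fun x => ?_
    change (show Module.Dual K C from f) (1 * x) = _
    rw [one_mul]
  mul_smul c d φ := by
    refine LinearMap.ext fun f => ?_
    change (show DualRegular K C →ₗ[C] M from φ) _ = (show DualRegular K C →ₗ[C] M from φ) _
    congr 1
    refine LinearMap.ext fun x => ?_
    change (show Module.Dual K C from f) (c * d * x) = (show Module.Dual K C from f) (c * (d * x))
    rw [mul_assoc]
  smul_zero c := rfl
  smul_add c φ ψ := rfl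
  add_smul c d φ := by
    refine LinearMap.ext fun f => ?_
    change (show DualRegular K C →ₗ[C] M from φ) _ =
      (show DualRegular K C →ₗ[C] M from φ) _ + (show DualRegular K C →ₗ[C] M from φ) _
    rw [← map_add]
    congr 1
    refine LinearMap.ext fun x => ?_
    change (show Module.Dual K C from f) ((c + d) * x) =
      (show Module.Dual K C from f) (c * x) + (show Module.Dual K C from f) (d * x)
    rw [add_mul, map_add]
  zero_smul φ := by
    refine LinearMap.ext fun f => ?_
    change (show DualRegular K C →ₗ[C] M from φ) _ = 0
    rw [← map_zero (show DualRegular K C →ₗ[C] M from φ)]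
    congr 1
    refine LinearMap.ext fun x => ?_
    change (show Module.Dual K C from f) (0 * x) = 0
    rw [zero_mul, map_zero]

lemma InvNakayamaObj.smul_apply {M : Type u} [AddCommGroup M] [Module C M] (c : C)
    (φ : InvNakayamaObj K C M) (f : DualRegular K C) :
    (show DualRegular K C →ₗ[C] M from c • φ) f =
      (show DualRegular K C →ₗ[C] M from φ) (dualRightMul K C c f) := rfl

/-! ### Finiteness -/

variable [Module.Finite K C]

lemma finite_of_finite (M : Type u) [AddCommGroup M] [Module C M] [Module.Finite C M]
    [Module K M] [IsScalarTower K C M] : Module.Finite K M :=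
  Module.Finite.trans C M

lemma finite_hom (M N : Type u) [AddCommGroup M] [Module C M] [Module.Finite C M]
    [AddCommGroup N] [Module C N] [Module K N] [IsScalarTower K C N] [SMulCommClass C K N]
    [Module.Finite K N] : Module.Finite K (M →ₗ[C] N) := by
  let : Module K M := Module.compHom M (algebraMap K C)
  have : IsScalarTower K C M := ⟨fun a c m => by
    rw [Algebra.smul_def, mul_smul]; rfl⟩
  have : Module.Finite K M := finite_of_finite K C M
  let r : (M →ₗ[C] N) →ₗ[K] (M →ₗ[K] N) :=
    { toFun := fun φ => φ.restrictScalars K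
      map_add' := fun _ _ => rfl
      map_smul' := fun _ _ => rfl }
  exact Module.Finite.of_injective r (LinearMap.restrictScalars_injective K)

instance (M : Type u) [AddCommGroup M] [Module C M] [Module.Finite C M] :
    Module.Finite C (NakayamaObj K C M) := by
  have : Module.Finite K (M →ₗ[C] C) := finite_hom K C M C
  have : Module.Finite K (NakayamaObj K C M) :=
    inferInstanceAs (Module.Finite K (Module.Dual K (M →ₗ[C] C)))
  exact Module.Finite.of_restrictScalars_finite K C _

instance : Module.Finite C (DualRegular K C) := by
  have : Module.Finite K (DualRegular K C) :=
    inferInstanceAs (Module.Finite K (Module.Dual K C))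
  exact Module.Finite.of_restrictScalars_finite K C _

instance (M : Type u) [AddCommGroup M] [Module C M] [Module.Finite C M] :
    Module.Finite C (InvNakayamaObj K C M) := by
  let : Module K M := Module.compHom M (algebraMap K C)
  have : IsScalarTower K C M := ⟨fun a c m => by
    rw [Algebra.smul_def, mul_smul]; rfl⟩
  have : SMulCommClass C K M := ⟨fun c a m => by
    change c • (algebraMap K C a) • m = (algebraMap K C a) • c • m
    rw [← mul_smul, ← mul_smul, Algebra.commutes]⟩
  have : Module.Finite K M := finite_of_finite K C M
  have : Module.Finite K (DualRegular K C →ₗ[C] M) := finite_hom K C _ M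
  let : Module K (InvNakayamaObj K C M) :=
    inferInstanceAs (Module K (DualRegular K C →ₗ[C] M))
  have : Module.Finite K (InvNakayamaObj K C M) :=
    inferInstanceAs (Module.Finite K (DualRegular K C →ₗ[C] M))
  have : IsScalarTower K C (InvNakayamaObj K C M) := ⟨fun a c φ => by
    refine LinearMap.ext fun f => ?_
    change (show DualRegular K C →ₗ[C] M from φ) (dualRightMul K C (a • c) f) =
      a • (show DualRegular K C →ₗ[C] M from φ) (dualRightMul K C c f)
    rw [← LinearMap.map_smul_of_tower]
    congr 1
    refine LinearMap.ext fun x => ?_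
    change (show Module.Dual K C from f) ((a • c) * x) =
      a • (show Module.Dual K C from f) (c * x)
    rw [smul_mul_assoc, map_smul]⟩
  exact Module.Finite.of_restrictScalars_finite K C _

/-! ### The functors -/

/-- The Nakayama functor `ν = D Hom_C(-, C) : mod C ⥤ mod C`
(naturally isomorphic to `DC ⊗_C -`). -/
noncomputable def nakayama : FGModuleCat.{u} C ⥤ FGModuleCat.{u} C where
  obj M := FGModuleCat.of C (NakayamaObj K C M)
  map {M N} g := FGModuleCat.ofHom
    { toFun := fun ξ => LinearMap.comp (σ₁₂ := RingHom.id K) (σ₂₃ := RingHom.id K)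
        (show Module.Dual K (M →ₗ[C] C) from ξ) (LinearMap.lcomp K C g.hom.hom)
      map_add' := fun _ _ => rfl
      map_smul' := fun _ _ => rfl }
  map_id M := rfl
  map_comp f g := rfl

instance : (nakayama K C).Additive where
  map_add {M N f g} := by
    ext ξ
    refine LinearMap.ext fun φ => ?_
    change (show Module.Dual K (M →ₗ[C] C) from ξ) _ =
      (show Module.Dual K (M →ₗ[C] C) from ξ) _ + (show Module.Dual K (M →ₗ[C] C) from ξ) _
    rw [← map_add]
    congr 1
    refine LinearMap.ext fun m => ?_
    exact map_add φ _ _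

/-- The functor `Hom_C(DC, -) : mod C ⥤ mod C`, the right adjoint of the Nakayama functor. -/
noncomputable def invNakayama : FGModuleCat.{u} C ⥤ FGModuleCat.{u} C where
  obj M := FGModuleCat.of C (InvNakayamaObj K C M)
  map {M N} g := FGModuleCat.ofHom
    { toFun := fun φ => LinearMap.comp (σ₁₂ := RingHom.id C) (σ₂₃ := RingHom.id C)
        g.hom.hom (show DualRegular K C →ₗ[C] M from φ)
      map_add' := fun φ ψ => by
        refine LinearMap.ext fun f => ?_
        exact map_add g.hom.hom _ _
      map_smul' := fun _ _ => rfl }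
  map_id M := rfl
  map_comp f g := rfl

instance : (invNakayama K C).Additive where
  map_add {M N f g} := rfl

end Modules

section Coinduced

variable (K : Type u) [Field K] (C : Type u) [Ring C] [Algebra K C]
  (M : Type u) [AddCommGroup M] [Module K M]

/-- The underlying space of the coinduced left `C`-module `Hom_K(C, M)`. -/
def Coind : Type u := C →ₗ[K] M

instance : AddCommGroup (Coind K C M) := inferInstanceAs (AddCommGroup (C →ₗ[K] M))

instance : Module K (Coind K C M) := inferInstanceAs (Module K (C →ₗ[K] M))

/-- The left action of `C` on `Hom_K(C, M)`: `(c • φ)(x) = φ(x c)`. -/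
instance : Module C (Coind K C M) where
  smul c φ := LinearMap.comp (σ₁₂ := RingHom.id K) (σ₂₃ := RingHom.id K)
    (show C →ₗ[K] M from φ) (LinearMap.mulRight K c)
  one_smul φ := LinearMap.ext fun x => congrArg (show C →ₗ[K] M from φ) (mul_one x)
  mul_smul c d φ := LinearMap.ext fun x =>
    congrArg (show C →ₗ[K] M from φ) (mul_assoc x c d).symm
  smul_zero _ := rfl
  smul_add _ _ _ := rfl
  add_smul c d φ := LinearMap.ext fun x =>
    (congrArg (show C →ₗ[K] M from φ) (mul_add x c d)).trans
      (map_add (show C →ₗ[K] M from φ) _ _)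
  zero_smul φ := LinearMap.ext fun x =>
    (congrArg (show C →ₗ[K] M from φ) (mul_zero x)).trans (map_zero (show C →ₗ[K] M from φ))

instance : IsScalarTower K C (Coind K C M) where
  smul_assoc a c φ := LinearMap.ext fun x =>
    (congrArg (show C →ₗ[K] M from φ) (mul_smul_comm a x c)).trans
      (map_smul (show C →ₗ[K] M from φ) _ _)

lemma finite_coind [Module.Finite K C] [Module.Finite K M] : Module.Finite C (Coind K C M) := by
  have : Module.Finite K (Coind K C M) := inferInstanceAs (Module.Finite K (C →ₗ[K] M))
  exact Module.Finite.of_restrictScalars_finite K C _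

end Coinduced

/-- `mod C` has enough injectives: `M` embeds into the coinduced module `Hom_K(C, M)`. -/
lemma enoughInjectives (K : Type u) [Field K] (C : Type u) [Ring C] [Algebra K C]
    [Module.Finite K C] : EnoughInjectives (FGModuleCat.{u} C) where
  presentation M := by
    let _ : Module K M := Module.compHom M (algebraMap K C)
    have : IsScalarTower K C M := ⟨fun a c m => by
      rw [Algebra.smul_def, mul_smul]; rfl⟩
    have : Module.Finite K M := finite_of_finite K C M
    have : Module.Finite C (Coind K C M) := finite_coind K C M
    let J : FGModuleCat.{u} C := FGModuleCat.of C (Coind K C M)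
    let ι : M →ₗ[C] Coind K C M :=
      { toFun := fun m => (LinearMap.toSpanSingleton C M m).restrictScalars K
        map_add' := fun m n => LinearMap.ext fun x => smul_add x m n
        map_smul' := fun c m => LinearMap.ext fun x => (mul_smul x c m).symm }
    have hι : Function.Injective ι := fun m n h => by
      have h1 := LinearMap.congr_fun h (1 : C)
      change (1 : C) • m = (1 : C) • n at h1
      simpa using h1
    have : IsNoetherianRing C := IsNoetherianRing.of_finite K C
    let ev : Coind K C M → C →ₗ[K] M := fun φ => φ
    refine ⟨J, ⟨fun {X Y} g f hf => ?_⟩, FGModuleCat.ofHom ι, ?_⟩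
    · let _ : Module K X := Module.compHom X (algebraMap K C)
      let _ : Module K Y := Module.compHom Y (algebraMap K C)
      have : IsScalarTower K C X := ⟨fun a c m => by
        rw [Algebra.smul_def, mul_smul]; rfl⟩
      have : IsScalarTower K C Y := ⟨fun a c m => by
        rw [Algebra.smul_def, mul_smul]; rfl⟩
      have hinj : Function.Injective f.hom.hom :=
        (ModuleCat.mono_iff_injective _).1 ((forget₂ (FGModuleCat C) (ModuleCat C)).map_mono f)
      let g' : X →ₗ[C] Coind K C M := g.hom.hom
      let f' : X →ₗ[C] Y := f.hom.hom
      let gb : X →ₗ[K] M :=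
        { toFun := fun x => ev (g' x) 1
          map_add' := fun x y => by rw [map_add]; rfl
          map_smul' := fun a x => by
            have h : a • x = (algebraMap K C a) • x := rfl
            rw [h, map_smul]
            change ev (g' x) (1 * algebraMap K C a) = a • ev (g' x) 1
            rw [one_mul, Algebra.algebraMap_eq_smul_one, map_smul] }
      obtain ⟨r, hr⟩ := (f'.restrictScalars K).exists_leftInverse_of_injective
        (LinearMap.ker_eq_bot.2 hinj)
      let h : Y →ₗ[C] Coind K C M :=
        { toFun := fun y => gb ∘ₗ r ∘ₗ (LinearMap.toSpanSingleton C Y y).restrictScalars K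
          map_add' := fun y z => LinearMap.ext fun x => by
            change gb (r (x • (y + z))) = gb (r (x • y)) + gb (r (x • z))
            rw [smul_add, map_add, map_add]
          map_smul' := fun c y => LinearMap.ext fun x => by
            change gb (r (x • c • y)) = gb (r ((x * c) • y))
            rw [mul_smul] }
      refine ⟨FGModuleCat.ofHom h, ?_⟩
      ext x
      refine LinearMap.ext fun c => ?_
      change gb (r (c • f' x)) = ev (g' x) c
      rw [← map_smul]
      have h2 : r (f' (c • x)) = c • x := LinearMap.congr_fun hr (c • x)
      rw [h2]
      change ev (g' (c • x)) 1 = ev (g' x) c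
      rw [map_smul]
      exact congrArg (ev (g' x)) (one_mul c)
    · exact (forget₂ (FGModuleCat C) (ModuleCat C)).mono_of_mono_map
        ((ModuleCat.mono_iff_injective _).2 hι)

/-! ### The derived category -/

section Derived

/-- `C` has (left) global dimension at most `n`: every finitely generated left `C`-module has
projective dimension at most `n`. -/
def GlobalDimensionLE (C : Type u) [Ring C] [IsNoetherianRing C] (n : ℕ) : Prop :=
  ∀ M : FGModuleCat.{u} C, HasProjectiveDimensionLE M n

/-- `Ext^n(X, Y) = 0` in an abelian category. -/
def ExtVanishes {A : Type*} [Category* A] [Abelian A] (X Y : A) (n : ℕ) : Prop :=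
  let _ := HasExt.standard A
  Subsingleton (Abelian.Ext X Y n)

section

variable {A : Type*} [Category* A] [Abelian A]

/-- A bounded cochain complex all of whose terms are projective. -/
structure IsBoundedProjective (P : CochainComplex A ℤ) : Prop where
  bounded : ∃ a b : ℤ, P.IsStrictlyGE a ∧ P.IsStrictlyLE b
  projective : ∀ i : ℤ, Projective (P.X i)

variable [HasDerivedCategory.{w} A]

/-- The objects of the derived category in (the essential image of) `K^b(proj A)`, that is, those
isomorphic to a bounded complex of projective objects. In particular they lie in `D^b(A)`. -/
def IsPerfect (X : DerivedCategory A) : Prop :=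
  ∃ P : CochainComplex A ℤ, IsBoundedProjective P ∧ Nonempty (X ≅ DerivedCategory.Q.obj P)

/-- Tilting complexes: `T` lies in `K^b(proj A)`, has no nonzero self-extensions of nonzero degree,
and `K^b(proj A)` is contained in the smallest thick triangulated subcategory containing `T`. -/
structure IsTiltingComplex (T : DerivedCategory A) : Prop where
  perfect : IsPerfect T
  hom_shift_eq_zero : ∀ n : ℤ, n ≠ 0 → ∀ f : T ⟶ T⟦n⟧, f = 0
  generates : ∀ X : DerivedCategory A, IsPerfect X →
    (ObjectProperty.singleton T).triangEnvelope X

end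

variable (K : Type u) [Field K] (C : Type u) [Ring C] [Algebra K C] [Module.Finite K C]
  [IsNoetherianRing C] [HasDerivedCategory.{w} (FGModuleCat.{u} C)]

/-- `Y` is the value at `X` of the derived Nakayama functor (the left derived functor of `ν`):
`Y` is obtained by applying `ν` to a bounded projective resolution of `X`. If `C` has finite global
dimension, every object `X` of `D^b(mod C)` has such a resolution. -/
def IsDerivedNakayama (X Y : DerivedCategory (FGModuleCat.{u} C)) : Prop :=
  ∃ P : CochainComplex (FGModuleCat.{u} C) ℤ, IsBoundedProjective P ∧
    Nonempty (X ≅ DerivedCategory.Q.obj P) ∧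
    Nonempty (Y ≅ DerivedCategory.Q.obj
      (((nakayama K C).mapHomologicalComplex (ComplexShape.up ℤ)).obj P))

/-- The inverse of the derived Nakayama functor, `ν⁻¹ = RHom_C(DC, -)`. -/
noncomputable def derivedInvNakayama :
    DerivedCategory.Plus (FGModuleCat.{u} C) ⥤ DerivedCategory.Plus (FGModuleCat.{u} C) :=
  have := enoughInjectives K C
  (invNakayama K C).rightDerivedFunctorPlus

/-- The inverse `τ⁻¹ = ν⁻¹[1]` of the Auslander-Reiten translation `τ = ν[-1]`. -/
noncomputable def tauInv :
    DerivedCategory.Plus (FGModuleCat.{u} C) ⥤ DerivedCategory.Plus (FGModuleCat.{u} C) :=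
  derivedInvNakayama K C ⋙ shiftFunctor _ (1 : ℤ)

/-- `F = τ⁻¹[1]`. -/
noncomputable def F :
    DerivedCategory.Plus (FGModuleCat.{u} C) ⥤ DerivedCategory.Plus (FGModuleCat.{u} C) :=
  tauInv K C ⋙ shiftFunctor _ (1 : ℤ)

/-- The object `F M` of the derived category, for a module `M` placed in degree `0`. -/
noncomputable def FObj (M : FGModuleCat.{u} C) : DerivedCategory (FGModuleCat.{u} C) :=
  DerivedCategory.Plus.ι.obj ((F K C).obj ((DerivedCategory.Plus.singleFunctor _ 0).obj M))

end Derived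

end TwoAPR

/-!
The proof rests on two properties of the Nakayama functor `ν = D Hom_C(-, C)`: it is fully faithful
on projective modules and takes them to injective modules (`IsProjectiveEmbedding`,
`isProjectiveEmbedding_nakayama`). Let `R` and `S` be bounded complexes of projectives. Morphisms
`R ⟶ S` in the derived category are homotopy classes of maps of complexes since `R` is K-projective,
and so are morphisms `ν R ⟶ ν S` since `ν S` is K-injective. Hence vanishing of morphisms,
isomorphisms and retracts between `R` and `S` may be tested on `ν R` and `ν S`.

Every injective module is `ν P` with `P` projective, so finite global dimension yields a bounded
complex of projectives `R` with `ν R ≅ C₀` (`derivedImage_nakayama_top`). Computing `RHom_C(DC, -)`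
on the complex of injectives `ν R` gives `F C₀ ≅ R⟦2⟧` (`nonempty_FObj_iso`), and the first claim
follows because `ν` reflects isomorphisms.

For the vanishing of self-extensions, `ν` turns the summands of `T` into `C₀⟦2⟧` and `ν C_R`. What
remains is to see that `Ext` vanishes in the relevant degrees between these modules. As
`Hom_C(C_R, C₀) = 0` amounts to `C_R C₀ = 0` in `C`, the module `ν C_R` is annihilated by `C₀`, so
there are no morphisms between `C₀` and `ν C_R` in either direction. Degree one is the hypothesis on
`Ext¹`, degree two would contribute to `Hom(T, T)` only, and the degrees above two vanish by the
bound on the global dimension.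

For generation, let `W` be the thick subcategory generated by `T`. Its image under `ν` is a
triangulated subcategory (`IsProjectiveEmbedding.isTriangulated_derivedImage`) containing `C₀` and
`ν C_R`. Modules annihilated by `C_R` have finite resolutions by summands of powers of `C₀`, and
modules annihilated by `C₀` have finite coresolutions by summands of powers of `ν C_R`. Every module
is an extension of one of the latter by one of the former, so the image of `W` contains all modules.
It contains `ν C₀`, therefore `W` contains `C₀`, so it contains `C = C₀ ⊕ C_R`, all modules
(`prop_single_of_isCompl`) and all perfect complexes (`prop_of_isPerfect`).
-/


namespace TwoAPR

/-! ### Bounded complexes of projectives and functors fully faithful on projectives -/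

section DerivedLift

open ZeroObject

variable {A : Type*} [Category* A] [Abelian A]

section

variable [HasDerivedCategory.{w} A]

lemma Q_map_eq_Qh_map {X Y : CochainComplex A ℤ} (f : X ⟶ Y) :
    DerivedCategory.Q.map f = (DerivedCategory.quotientCompQhIso A).inv.app X ≫
      DerivedCategory.Qh.map ((HomotopyCategory.quotient _ _).map f) ≫
      (DerivedCategory.quotientCompQhIso A).hom.app Y := by
  have := (DerivedCategory.quotientCompQhIso A).hom.naturality f
  dsimp at this
  rw [this, Iso.inv_hom_id_app_assoc]

lemma exists_Q_map_eq {X Y : CochainComplex A ℤ}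
    (h : Function.Surjective (DerivedCategory.Qh.map :
      ((HomotopyCategory.quotient _ _).obj X ⟶ (HomotopyCategory.quotient _ _).obj Y) → _))
    (f : DerivedCategory.Q.obj X ⟶ DerivedCategory.Q.obj Y) :
    ∃ g : X ⟶ Y, DerivedCategory.Q.map g = f := by
  obtain ⟨φ, hφ⟩ := h ((DerivedCategory.quotientCompQhIso A).hom.app X ≫ f ≫
    (DerivedCategory.quotientCompQhIso A).inv.app Y)
  obtain ⟨g, rfl⟩ := (HomotopyCategory.quotient _ _).map_surjective φ
  exact ⟨g, by rw [Q_map_eq_Qh_map, hφ]; simp⟩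

lemma nonempty_homotopy_of_Q_map_eq {X Y : CochainComplex A ℤ}
    (h : Function.Injective (DerivedCategory.Qh.map :
      ((HomotopyCategory.quotient _ _).obj X ⟶ (HomotopyCategory.quotient _ _).obj Y) → _))
    {f g : X ⟶ Y} (hfg : DerivedCategory.Q.map f = DerivedCategory.Q.map g) :
    Nonempty (Homotopy f g) := by
  refine ⟨HomotopyCategory.homotopyOfEq _ _ (h ?_)⟩
  rw [Q_map_eq_Qh_map, Q_map_eq_Qh_map] at hfg
  exact (cancel_mono _).1 ((cancel_epi _).1 hfg)

end

lemma IsBoundedProjective.isKProjective {R : CochainComplex A ℤ} (hR : IsBoundedProjective R) :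
    R.IsKProjective := by
  obtain ⟨_, b, _, _⟩ := hR.bounded
  have := hR.projective
  exact CochainComplex.isKProjective_of_projective R b

lemma IsBoundedProjective.shift {R : CochainComplex A ℤ} (hR : IsBoundedProjective R) (n : ℤ) :
    IsBoundedProjective (R⟦n⟧) where
  bounded := by
    obtain ⟨a, b, _, _⟩ := hR.bounded
    exact ⟨a - n, b - n, R.isStrictlyGE_shift a n _ (by lia), R.isStrictlyLE_shift b n _ (by lia)⟩
  projective i := hR.projective (i + n)

lemma IsBoundedProjective.mappingCone {R S : CochainComplex A ℤ} (hR : IsBoundedProjective R)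
    (hS : IsBoundedProjective S) (f : R ⟶ S) :
    IsBoundedProjective (CochainComplex.mappingCone f) where
  bounded := by
    obtain ⟨a, b, _, _⟩ := hR.bounded
    obtain ⟨a', b', _, _⟩ := hS.bounded
    refine ⟨min (a - 1) a', max b b', ?_, ?_⟩
    · rw [CochainComplex.isStrictlyGE_iff]
      intro i hi
      simp at hi
      rw [CochainComplex.mappingCone.isZero_X_iff]
      exact ⟨R.isZero_of_isStrictlyGE a _ (by lia), S.isZero_of_isStrictlyGE a' _ (by lia)⟩
    · rw [CochainComplex.isStrictlyLE_iff]
      intro i hi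
      simp at hi
      rw [CochainComplex.mappingCone.isZero_X_iff]
      exact ⟨R.isZero_of_isStrictlyLE b _ (by lia), S.isZero_of_isStrictlyLE b' _ (by lia)⟩
  projective i := by
    have := hR.projective (i + 1)
    have := hS.projective i
    exact Projective.of_iso (HomologicalComplex.homotopyCofiber.XIsoBiprod f i (i + 1) rfl).symm
      inferInstance

lemma isBoundedProjective_single (P : A) [Projective P] (n : ℤ) :
    IsBoundedProjective ((HomologicalComplex.single A (ComplexShape.up ℤ) n).obj P) where
  bounded := ⟨n, n, inferInstance, inferInstance⟩
  projective i := by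
    by_cases h : i = n
    · subst h
      exact Projective.of_iso (HomologicalComplex.singleObjXSelf (.up ℤ) i P).symm inferInstance
    · exact (HomologicalComplex.isZero_single_obj_X (.up ℤ) n P i h).projective

/-- An additive functor is a *projective embedding* if it is fully faithful on projective objects
and takes them to injective objects. The Nakayama functor is the motivating example. -/
structure IsProjectiveEmbedding (ν : A ⥤ A) : Prop where
  map_bijective : ∀ (P Q : A) [Projective P] [Projective Q],
    Function.Bijective (ν.map : (P ⟶ Q) → (ν.obj P ⟶ ν.obj Q))
  injective_obj : ∀ (P : A) [Projective P], Injective (ν.obj P)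

namespace IsProjectiveEmbedding

variable {ν : A ⥤ A} [ν.Additive] (hν : IsProjectiveEmbedding ν)

include hν in
lemma exists_mapHomologicalComplex_map_eq {R S : CochainComplex A ℤ}
    (hR : IsBoundedProjective R) (hS : IsBoundedProjective S)
    (f : (ν.mapHomologicalComplex (.up ℤ)).obj R ⟶ (ν.mapHomologicalComplex (.up ℤ)).obj S) :
    ∃ g : R ⟶ S, (ν.mapHomologicalComplex (.up ℤ)).map g = f := by
  have := hR.projective
  have := hS.projective
  choose g hg using fun i => (hν.map_bijective (R.X i) (S.X i)).surjective (f.f i)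
  refine ⟨{ f := g, comm' := fun i j _ => (hν.map_bijective _ _).injective ?_ }, ?_⟩
  · rw [ν.map_comp, ν.map_comp, hg, hg]
    exact f.comm i j
  · ext i
    exact hg i

include hν in
lemma nonempty_homotopy {R S : CochainComplex A ℤ}
    (hR : IsBoundedProjective R) (hS : IsBoundedProjective S) {f g : R ⟶ S}
    (h : Homotopy ((ν.mapHomologicalComplex (.up ℤ)).map f)
      ((ν.mapHomologicalComplex (.up ℤ)).map g)) : Nonempty (Homotopy f g) := by
  have := hR.projective
  have := hS.projective
  choose s hs using fun i j => (hν.map_bijective (R.X i) (S.X j)).surjective (h.hom i j)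
  refine ⟨⟨s, fun i j hij => (hν.map_bijective _ _).injective ?_,
    fun i => (hν.map_bijective _ _).injective ?_⟩⟩
  · rw [hs, ν.map_zero]
    exact h.zero i j hij
  · have := h.comm i
    simp only [dNext, prevD, AddMonoidHom.mk'_apply, ν.map_add, ν.map_comp, hs] at this ⊢
    exact this

include hν in
lemma isKInjective {R : CochainComplex A ℤ} (hR : IsBoundedProjective R) :
    CochainComplex.IsKInjective ((ν.mapHomologicalComplex (.up ℤ)).obj R) := by
  obtain ⟨a, _, _, _⟩ := hR.bounded
  have (i : ℤ) : Injective (((ν.mapHomologicalComplex (.up ℤ)).obj R).X i) :=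
    have := hR.projective i
    hν.injective_obj _
  have : CochainComplex.IsStrictlyGE ((ν.mapHomologicalComplex (.up ℤ)).obj R) a := inferInstance
  exact CochainComplex.isKInjective_of_injective _ a

variable [HasDerivedCategory.{w} A]

lemma exists_Q_map_eq_of_isBoundedProjective {R S : CochainComplex A ℤ}
    (hR : IsBoundedProjective R) (f : DerivedCategory.Q.obj R ⟶ DerivedCategory.Q.obj S) :
    ∃ g : R ⟶ S, DerivedCategory.Q.map g = f :=
  have := hR.isKProjective
  exists_Q_map_eq (CochainComplex.IsKProjective.Qh_map_bijective _ _).surjective f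

include hν in
/-- Morphisms in the derived category between the images of two bounded complexes of projectives
come from morphisms between these complexes: the images are bounded complexes of injectives, and
the functor is full on projectives. -/
lemma exists_Q_map_map_eq {R S : CochainComplex A ℤ}
    (hR : IsBoundedProjective R) (hS : IsBoundedProjective S)
    (f : DerivedCategory.Q.obj ((ν.mapHomologicalComplex (.up ℤ)).obj R) ⟶
      DerivedCategory.Q.obj ((ν.mapHomologicalComplex (.up ℤ)).obj S)) :
    ∃ g : R ⟶ S, DerivedCategory.Q.map ((ν.mapHomologicalComplex (.up ℤ)).map g) = f := by
  have := hν.isKInjective hS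
  obtain ⟨g, rfl⟩ := exists_Q_map_eq
    (CochainComplex.IsKInjective.Qh_map_bijective _ _).surjective f
  obtain ⟨g, rfl⟩ := hν.exists_mapHomologicalComplex_map_eq hR hS g
  exact ⟨g, rfl⟩

include hν in
lemma Q_map_eq_iff {R S : CochainComplex A ℤ}
    (hR : IsBoundedProjective R) (hS : IsBoundedProjective S) (f g : R ⟶ S) :
    DerivedCategory.Q.map ((ν.mapHomologicalComplex (.up ℤ)).map f) =
      DerivedCategory.Q.map ((ν.mapHomologicalComplex (.up ℤ)).map g) ↔
    DerivedCategory.Q.map f = DerivedCategory.Q.map g := by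
  constructor
  · intro h
    have := hν.isKInjective hS
    obtain ⟨h⟩ := nonempty_homotopy_of_Q_map_eq
      (CochainComplex.IsKInjective.Qh_map_bijective _ _).injective h
    obtain ⟨h⟩ := hν.nonempty_homotopy hR hS h
    exact DerivedCategory.Q_map_eq_of_homotopy _ h
  · intro h
    have := hR.isKProjective
    obtain ⟨h⟩ := nonempty_homotopy_of_Q_map_eq
      (CochainComplex.IsKProjective.Qh_map_bijective _ _).injective h
    exact DerivedCategory.Q_map_eq_of_homotopy _ (ν.mapHomotopy h)

include hν in
/-- Vanishing of morphisms can be tested after applying a projective embedding. -/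
lemma eq_zero_of_forall_eq_zero {R S : CochainComplex A ℤ}
    (hR : IsBoundedProjective R) (hS : IsBoundedProjective S)
    (h : ∀ f : DerivedCategory.Q.obj ((ν.mapHomologicalComplex (.up ℤ)).obj R) ⟶
      DerivedCategory.Q.obj ((ν.mapHomologicalComplex (.up ℤ)).obj S), f = 0)
    (f : DerivedCategory.Q.obj R ⟶ DerivedCategory.Q.obj S) : f = 0 := by
  obtain ⟨g, rfl⟩ := exists_Q_map_eq_of_isBoundedProjective hR f
  rw [← DerivedCategory.Q.map_zero, ← hν.Q_map_eq_iff hR hS]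
  rw [h (DerivedCategory.Q.map _)]
  simp

include hν in
/-- Retracts can be lifted along a projective embedding. -/
lemma nonempty_retract {R S : CochainComplex A ℤ}
    (hR : IsBoundedProjective R) (hS : IsBoundedProjective S)
    (e : Retract (DerivedCategory.Q.obj ((ν.mapHomologicalComplex (.up ℤ)).obj R))
      (DerivedCategory.Q.obj ((ν.mapHomologicalComplex (.up ℤ)).obj S))) :
    Nonempty (Retract (DerivedCategory.Q.obj R) (DerivedCategory.Q.obj S)) := by
  obtain ⟨i, hi⟩ := hν.exists_Q_map_map_eq hR hS e.i
  obtain ⟨r, hr⟩ := hν.exists_Q_map_map_eq hS hR e.r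
  refine ⟨⟨DerivedCategory.Q.map i, DerivedCategory.Q.map r, ?_⟩⟩
  rw [← DerivedCategory.Q.map_comp, ← DerivedCategory.Q.map_id, ← hν.Q_map_eq_iff hR hR,
    Functor.map_comp, Functor.map_comp, hi, hr, e.retract]
  simp

include hν in
/-- A projective embedding reflects isomorphisms in the derived category between bounded complexes
of projectives. -/
lemma nonempty_iso {R S : CochainComplex A ℤ}
    (hR : IsBoundedProjective R) (hS : IsBoundedProjective S)
    (e : DerivedCategory.Q.obj ((ν.mapHomologicalComplex (.up ℤ)).obj R) ≅
      DerivedCategory.Q.obj ((ν.mapHomologicalComplex (.up ℤ)).obj S)) :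
    Nonempty (DerivedCategory.Q.obj R ≅ DerivedCategory.Q.obj S) := by
  obtain ⟨i, hi⟩ := hν.exists_Q_map_map_eq hR hS e.hom
  obtain ⟨r, hr⟩ := hν.exists_Q_map_map_eq hS hR e.inv
  refine ⟨⟨DerivedCategory.Q.map i, DerivedCategory.Q.map r, ?_, ?_⟩⟩
  · rw [← DerivedCategory.Q.map_comp, ← DerivedCategory.Q.map_id, ← hν.Q_map_eq_iff hR hR,
      Functor.map_comp, Functor.map_comp, hi, hr, e.hom_inv_id]
    simp
  · rw [← DerivedCategory.Q.map_comp, ← DerivedCategory.Q.map_id, ← hν.Q_map_eq_iff hS hS,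
      Functor.map_comp, Functor.map_comp, hi, hr, e.inv_hom_id]
    simp

end IsProjectiveEmbedding

/-! ### The image of a subcategory under the derived functor -/

variable [HasDerivedCategory.{w} A] (ν : A ⥤ A) [ν.Additive]

/-- The image of `W` under the derived functor of `ν`: the objects of the derived category which
are isomorphic to `ν R` for a bounded complex of projectives `R` satisfying `W`. -/
def derivedImage (W : ObjectProperty (DerivedCategory A)) : ObjectProperty (DerivedCategory A) :=
  fun Y => ∃ R : CochainComplex A ℤ, IsBoundedProjective R ∧ W (DerivedCategory.Q.obj R) ∧
    Nonempty (Y ≅ DerivedCategory.Q.obj ((ν.mapHomologicalComplex (.up ℤ)).obj R))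

instance (W : ObjectProperty (DerivedCategory A)) :
    (derivedImage ν W).IsClosedUnderIsomorphisms where
  of_iso := by
    rintro X Y e ⟨R, hR, hW, ⟨e'⟩⟩
    exact ⟨R, hR, hW, ⟨e.symm ≪≫ e'⟩⟩

variable {ν}

lemma nonempty_Q_map_shift_iso (R : CochainComplex A ℤ) (n : ℤ) :
    Nonempty (DerivedCategory.Q.obj ((ν.mapHomologicalComplex (.up ℤ)).obj (R⟦n⟧)) ≅
      (DerivedCategory.Q.obj ((ν.mapHomologicalComplex (.up ℤ)).obj R))⟦n⟧) :=
  ⟨DerivedCategory.Q.mapIso (((ν.mapHomologicalComplex (.up ℤ)).commShiftIso n).app R) ≪≫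
    (DerivedCategory.Q.commShiftIso n).app _⟩

lemma derivedImage_single {W : ObjectProperty (DerivedCategory A)} (P : A) [Projective P]
    (hW : W ((DerivedCategory.singleFunctor A 0).obj P)) :
    derivedImage ν W ((DerivedCategory.singleFunctor A 0).obj (ν.obj P)) :=
  ⟨(HomologicalComplex.single A (.up ℤ) 0).obj P, isBoundedProjective_single P 0, hW,
    ⟨DerivedCategory.Q.mapIso
      ((HomologicalComplex.singleMapHomologicalComplex ν (.up ℤ) 0).app P).symm⟩⟩

/-- If `W` is triangulated, so is its image: a morphism between images lifts to one between the
complexes of projectives, and `ν` preserves mapping cones. -/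
lemma IsProjectiveEmbedding.isTriangulated_derivedImage (hν : IsProjectiveEmbedding ν)
    (W : ObjectProperty (DerivedCategory A)) [W.IsTriangulated] [W.IsClosedUnderIsomorphisms] :
    (derivedImage ν W).IsTriangulated := by
  have hshift : (derivedImage ν W).IsStableUnderShift ℤ :=
    { isStableUnderShiftBy n :=
        { le_shift := by
            rintro Y ⟨R, hR, hW, ⟨e⟩⟩
            obtain ⟨e'⟩ := nonempty_Q_map_shift_iso (ν := ν) R n
            refine ⟨R⟦n⟧, hR.shift n, ?_, ⟨(shiftFunctor _ n).mapIso e ≪≫ e'.symm⟩⟩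
            exact W.prop_of_iso ((DerivedCategory.Q.commShiftIso n).app R).symm
              (W.le_shift n _ hW) } }
  have hcone : (derivedImage ν W).IsTriangulatedClosed₃ := by
    refine ObjectProperty.IsTriangulatedClosed₃.mk' ?_
    rintro T hT ⟨R, hR, hWR, ⟨e⟩⟩ ⟨S, hS, hWS, ⟨e'⟩⟩
    obtain ⟨g, hg⟩ := hν.exists_Q_map_map_eq hR hS (e.inv ≫ T.mor₁ ≫ e'.hom)
    refine ⟨CochainComplex.mappingCone g, hR.mappingCone hS g, ?_, ⟨?_⟩⟩
    · exact W.ext_of_isTriangulatedClosed₃ _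
        (DerivedCategory.mappingCone_triangle_distinguished g) hWR hWS
    · refine Pretriangulated.Triangle.π₃.mapIso (Pretriangulated.isoTriangleOfIso₁₂ T _ hT
        (DerivedCategory.mappingCone_triangle_distinguished
          ((ν.mapHomologicalComplex (.up ℤ)).map g)) e e' ?_) ≪≫
        DerivedCategory.Q.mapIso (CochainComplex.mappingCone.mapHomologicalComplexIso g ν).symm
      change T.mor₁ ≫ e'.hom =
        e.hom ≫ DerivedCategory.Q.map ((ν.mapHomologicalComplex (.up ℤ)).map g)
      rw [hg, Iso.hom_inv_id_assoc]
  have hzero : (derivedImage ν W).ContainsZero :=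
    { exists_zero := by
        have h0 : IsZero ((DerivedCategory.singleFunctor A 0).obj (0 : A)) :=
          Functor.map_isZero _ (isZero_zero A)
        refine ⟨_, ?_, derivedImage_single (0 : A) (W.prop_of_isZero h0)⟩
        exact Functor.map_isZero _ (Functor.map_isZero _ (isZero_zero A)) }
  have := ObjectProperty.IsTriangulatedClosed₂.of_isTriangulatedClosed₃ (P := derivedImage ν W)
  exact { }

/-- An object in the image of `ν` which is a retract of an object of the image of `W` lies in the
image of `W`. -/
lemma IsProjectiveEmbedding.derivedImage_of_retract (hν : IsProjectiveEmbedding ν)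
    (W : ObjectProperty (DerivedCategory A)) [W.IsStableUnderRetracts]
    {X Y : DerivedCategory A} (e : Retract X Y) (hX : derivedImage ν ⊤ X)
    (hY : derivedImage ν W Y) : derivedImage ν W X := by
  obtain ⟨R, hR, -, ⟨eR⟩⟩ := hX
  obtain ⟨S, hS, hW, ⟨eS⟩⟩ := hY
  obtain ⟨r⟩ := hν.nonempty_retract hR hS
    ((Retract.ofIso eR.symm).trans (e.trans (Retract.ofIso eS)))
  exact ⟨R, hR, ObjectProperty.prop_of_retract _ r hW, ⟨eR⟩⟩

lemma IsProjectiveEmbedding.of_derivedImage (hν : IsProjectiveEmbedding ν)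
    (W : ObjectProperty (DerivedCategory A)) [W.IsClosedUnderIsomorphisms]
    {R : CochainComplex A ℤ} (hR : IsBoundedProjective R)
    (h : derivedImage ν W (DerivedCategory.Q.obj ((ν.mapHomologicalComplex (.up ℤ)).obj R))) :
    W (DerivedCategory.Q.obj R) := by
  obtain ⟨S, hS, hW, ⟨e⟩⟩ := h
  obtain ⟨e'⟩ := hν.nonempty_iso hR hS e
  exact W.prop_of_iso e'.symm hW

end DerivedLift

/-! ### Dimension shifting in triangulated subcategories of the derived category -/

section DimensionShifting

variable {A : Type*} [Category* A] [Abelian A] [HasDerivedCategory.{w} A]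
  (V : ObjectProperty (DerivedCategory A)) [V.IsTriangulated] [V.IsClosedUnderIsomorphisms]

lemma prop_single_X₂ {S : ShortComplex A} (hS : S.ShortExact)
    (h₁ : V ((DerivedCategory.singleFunctor A 0).obj S.X₁))
    (h₃ : V ((DerivedCategory.singleFunctor A 0).obj S.X₃)) :
    V ((DerivedCategory.singleFunctor A 0).obj S.X₂) :=
  V.ext_of_isTriangulatedClosed₂ _ hS.singleTriangle_distinguished h₁ h₃

/-- Induction on the projective dimension: `Φ` is a class of objects, each of which is covered by a
projective object of `V` with kernel in `Φ`. -/
lemma prop_single_of_hasProjectiveDimensionLT (Φ : ObjectProperty A)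
    (hproj : ∀ P : A, Φ P → Projective P → V ((DerivedCategory.singleFunctor A 0).obj P))
    (hepi : ∀ M : A, Φ M → ∃ (N : A) (π : N ⟶ M), Epi π ∧ Projective N ∧
      V ((DerivedCategory.singleFunctor A 0).obj N) ∧ Φ (kernel π))
    (n : ℕ) (M : A) (hM : Φ M) (hn : HasProjectiveDimensionLT M (n + 1)) :
    V ((DerivedCategory.singleFunctor A 0).obj M) := by
  induction n generalizing M with
  | zero => exact hproj M hM (projective_iff_hasProjectiveDimensionLT_one.2 hn)
  | succ n ih =>
    obtain ⟨N, π, _, hN, hV, hK⟩ := hepi M hM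
    let S := ShortComplex.mk (kernel.ι π) π (kernel.condition π)
    have hS : S.ShortExact := { exact := ShortComplex.exact_kernel π }
    have hK' := ih (kernel π) hK ((hS.hasProjectiveDimensionLT_X₃_iff n hN).1 hn)
    exact V.ext_of_isTriangulatedClosed₃ _ hS.singleTriangle_distinguished hK' hV

/-- Induction on the injective dimension: `Φ` is a class of objects, each of which embeds in an
injective object of `V` with cokernel in `Φ`. -/
lemma prop_single_of_hasInjectiveDimensionLT (Φ : ObjectProperty A)
    (hinj : ∀ I : A, Φ I → Injective I → V ((DerivedCategory.singleFunctor A 0).obj I))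
    (hmono : ∀ M : A, Φ M → ∃ (N : A) (i : M ⟶ N), Mono i ∧ Injective N ∧
      V ((DerivedCategory.singleFunctor A 0).obj N) ∧ Φ (cokernel i))
    (n : ℕ) (M : A) (hM : Φ M) (hn : HasInjectiveDimensionLT M (n + 1)) :
    V ((DerivedCategory.singleFunctor A 0).obj M) := by
  induction n generalizing M with
  | zero => exact hinj M hM (injective_iff_hasInjectiveDimensionLT_one.2 hn)
  | succ n ih =>
    obtain ⟨N, i, _, hN, hV, hK⟩ := hmono M hM
    let S := ShortComplex.mk i (cokernel.π i) (cokernel.condition i)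
    have hS : S.ShortExact := { exact := ShortComplex.exact_cokernel i }
    have hK' := ih (cokernel i) hK ((hS.hasInjectiveDimensionLT_X₃_iff n hN).2 hn)
    exact V.ext_of_isTriangulatedClosed₁ _ hS.singleTriangle_distinguished hV hK'

lemma prop_single_shift (M : A) (h : V ((DerivedCategory.singleFunctor A 0).obj M)) (n : ℤ) :
    V ((DerivedCategory.singleFunctor A n).obj M) :=
  V.prop_of_iso (((DerivedCategory.singleFunctors A).shiftIso (-n) n 0 (by lia)).app M)
    (V.le_shift (-n) _ h)

lemma prop_of_isGE_of_isLE (h : ∀ M : A, V ((DerivedCategory.singleFunctor A 0).obj M))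
    (d : ℕ) (a b : ℤ) (hd : b < a + d) (X : DerivedCategory A) [X.IsGE a] [X.IsLE b] : V X := by
  induction d generalizing a X with
  | zero => exact V.prop_of_isZero (DerivedCategory.TStructure.t.isZero X b a (by lia))
  | succ d ih =>
    let t := DerivedCategory.TStructure.t (C := A)
    have hT := t.triangleLTGE_distinguished (a + 1) X
    have h₃ : V ((t.truncGE (a + 1)).obj X) := by
      have : ((t.truncGE (a + 1)).obj X).IsLE b := inferInstance
      exact ih (a + 1) (by lia) _
    have h₁ : V ((t.truncLT (a + 1)).obj X) := by
      have : ((t.truncLT (a + 1)).obj X).IsLE a := inferInstance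
      have : ((t.truncLT (a + 1)).obj X).IsGE a := inferInstance
      obtain ⟨M, ⟨e⟩⟩ :=
        DerivedCategory.exists_iso_singleFunctor_obj_of_isGE_of_isLE ((t.truncLT (a + 1)).obj X) a
      exact V.prop_of_iso e.symm (prop_single_shift V M (h M) a)
    exact V.ext_of_isTriangulatedClosed₂ _ hT h₁ h₃

/-- A triangulated subcategory of the derived category which contains all objects of the abelian
category contains all perfect complexes, by induction along canonical truncations. -/
lemma prop_of_isPerfect (h : ∀ M : A, V ((DerivedCategory.singleFunctor A 0).obj M))
    (X : DerivedCategory A) (hX : IsPerfect X) : V X := by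
  obtain ⟨P, hP, ⟨e⟩⟩ := hX
  obtain ⟨a, b, _, _⟩ := hP.bounded
  exact V.prop_of_iso e.symm
    (prop_of_isGE_of_isLE V h (b + 1 - a).toNat a b (by lia) (DerivedCategory.Q.obj P))

end DimensionShifting

/-! ### Vanishing of shifted morphisms between objects of the heart -/

section Vanishing

variable {A : Type*} [Category* A] [Abelian A] [HasDerivedCategory.{w} A]

lemma shiftedHom_single_eq_zero_of_neg (X Y : A) (n : ℤ) (hn : n < 0)
    (f : (DerivedCategory.singleFunctor A 0).obj X ⟶
      ((DerivedCategory.singleFunctor A 0).obj Y)⟦n⟧) : f = 0 := by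
  have := (DerivedCategory.TStructure.t (C := A)).isGE_shift
    ((DerivedCategory.singleFunctor A 0).obj Y) 0 n (-n) (by lia)
  exact DerivedCategory.TStructure.t.zero f 0 (-n) (by lia)

lemma shiftedHom_single_eq_zero_of_ext (X Y : A) (n : ℕ) (h : ExtVanishes X Y n)
    (f : (DerivedCategory.singleFunctor A 0).obj X ⟶
      ((DerivedCategory.singleFunctor A 0).obj Y)⟦(n : ℤ)⟧) : f = 0 := by
  let _ := HasExt.standard A
  have : Subsingleton (Abelian.Ext X Y n) := h
  apply Abelian.Ext.homEquiv.symm.injective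
  exact Subsingleton.elim _ _

omit [HasDerivedCategory.{w} A] in
lemma extVanishes_of_hasProjectiveDimensionLT (X Y : A) (n m : ℕ) (hnm : n ≤ m)
    [HasProjectiveDimensionLT X n] : ExtVanishes X Y m :=
  let _ := HasExt.standard A
  HasProjectiveDimensionLT.subsingleton X n m hnm Y

omit [HasDerivedCategory.{w} A] in
lemma extVanishes_zero (X Y : A) (h : ∀ f : X ⟶ Y, f = 0) : ExtVanishes X Y 0 := by
  let _ := HasExt.standard A
  have : Subsingleton (X ⟶ Y) := ⟨fun f g => (h f).trans (h g).symm⟩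
  exact Abelian.Ext.homEquiv₀.subsingleton

lemma shiftedHom_single_eq_zero_of_projective (P Y : A) [Projective P] (n : ℤ)
    (h : n = 0 → ∀ f : P ⟶ Y, f = 0)
    (f : (DerivedCategory.singleFunctor A 0).obj P ⟶
      ((DerivedCategory.singleFunctor A 0).obj Y)⟦n⟧) : f = 0 := by
  obtain hn | ⟨m, rfl⟩ : n < 0 ∨ ∃ m : ℕ, n = m := by
    rcases lt_or_ge n 0 with hn | hn
    · exact Or.inl hn
    · exact Or.inr ⟨n.toNat, by lia⟩
  · exact shiftedHom_single_eq_zero_of_neg P Y n hn f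
  · refine shiftedHom_single_eq_zero_of_ext P Y m ?_ f
    rcases m with _ | m
    · exact extVanishes_zero P Y (h rfl)
    · have := projective_iff_hasProjectiveDimensionLT_one.1 (inferInstance : Projective P)
      exact extVanishes_of_hasProjectiveDimensionLT P Y 1 _ (by lia)

end Vanishing

/-! ### Finitely generated projective modules -/

section FGModules

variable {C : Type u} [Ring C]

lemma hom_surjective_of_epi [IsNoetherianRing C] {M N : FGModuleCat.{u} C} (f : M ⟶ N) [Epi f] :
    Function.Surjective f.hom.hom :=
  (ModuleCat.epi_iff_surjective _).1 ((forget₂ (FGModuleCat C) (ModuleCat C)).map_epi f)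

lemma hom_injective_of_mono [IsNoetherianRing C] {M N : FGModuleCat.{u} C} (f : M ⟶ N) [Mono f] :
    Function.Injective f.hom.hom :=
  (ModuleCat.mono_iff_injective _).1 ((forget₂ (FGModuleCat C) (ModuleCat C)).map_mono f)

lemma epi_of_hom_surjective {M N : FGModuleCat.{u} C} (f : M ⟶ N)
    (hf : Function.Surjective f.hom.hom) : Epi f :=
  (forget₂ (FGModuleCat C) (ModuleCat C)).epi_of_epi_map ((ModuleCat.epi_iff_surjective _).2 hf)

lemma mono_of_hom_injective {M N : FGModuleCat.{u} C} (f : M ⟶ N)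
    (hf : Function.Injective f.hom.hom) : Mono f :=
  (forget₂ (FGModuleCat C) (ModuleCat C)).mono_of_mono_map ((ModuleCat.mono_iff_injective _).2 hf)

lemma isIso_of_hom_bijective {M N : FGModuleCat.{u} C} (f : M ⟶ N)
    (hf : Function.Bijective f.hom.hom) : IsIso f := by
  have : IsIso ((forget₂ (FGModuleCat C) (ModuleCat C)).map f) :=
    (ConcreteCategory.isIso_iff_bijective _).2 hf
  exact isIso_of_reflects_iso f (forget₂ (FGModuleCat C) (ModuleCat C))

lemma projective_of_moduleProjective [IsNoetherianRing C] (M : Type u) [AddCommGroup M] [Module C M]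
    [Module.Finite C M] [Module.Projective C M] : Projective (FGModuleCat.of C M) where
  factors {E X} f e _ := by
    obtain ⟨h, hh⟩ := Module.projective_lifting_property e.hom.hom f.hom.hom
      (hom_surjective_of_epi e)
    exact ⟨FGModuleCat.ofHom h, FGModuleCat.hom_ext hh⟩

lemma exists_dualBasis [IsNoetherianRing C] (P : FGModuleCat.{u} C) [Projective P] :
    ∃ (n : ℕ) (p : Fin n → P) (φ : Fin n → P →ₗ[C] C), ∀ x, ∑ i, φ i x • p i = x := by
  obtain ⟨n, f, hf⟩ := Module.Finite.exists_fin' C P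
  let π : FGModuleCat.of C (Fin n → C) ⟶ P := FGModuleCat.ofHom f
  have : Epi π := epi_of_hom_surjective π hf
  let s : P →ₗ[C] (Fin n → C) := (Projective.factorThru (𝟙 P) π).hom.hom
  refine ⟨n, fun i => f (Pi.single i 1), fun i => LinearMap.proj i ∘ₗ s, fun x => ?_⟩
  have hs : f (s x) = x :=
    congrArg (fun g : P ⟶ P => g.hom.hom x) (Projective.factorThru_comp (𝟙 P) π)
  conv_rhs => rw [← hs, pi_eq_sum_univ' (s x), map_sum]
  refine Finset.sum_congr rfl fun i _ => ?_
  rw [← map_smul]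
  congr 1

end FGModules

/-! ### The Nakayama functor on projective modules -/

section Nakayama

variable {K : Type u} [Field K] {C : Type u} [Ring C] [Algebra K C]

/-- An element of `ν M = D Hom_C(M, C)` as a linear form. -/
def NakayamaObj.toDual {M : Type u} [AddCommGroup M] [Module C M] (ξ : NakayamaObj K C M) :
    Module.Dual K (M →ₗ[C] C) := ξ

/-- An element of `DC` as a linear form. -/
def DualRegular.toDual (f : DualRegular K C) : Module.Dual K C := f

lemma NakayamaObj.ext_toDual {M : Type u} [AddCommGroup M] [Module C M]
    {ξ η : NakayamaObj K C M} (h : ∀ φ, ξ.toDual φ = η.toDual φ) : ξ = η :=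
  LinearMap.ext h

lemma NakayamaObj.toDual_smul {M : Type u} [AddCommGroup M] [Module C M] (c : C)
    (ξ : NakayamaObj K C M) (φ : M →ₗ[C] C) :
    (c • ξ).toDual φ = ξ.toDual (homRightMul K C M c φ) := rfl

lemma NakayamaObj.toDual_sum {M : Type u} [AddCommGroup M] [Module C M] {ι : Type*}
    (s : Finset ι) (ξ : ι → NakayamaObj K C M) (φ : M →ₗ[C] C) :
    (∑ i ∈ s, ξ i).toDual φ = ∑ i ∈ s, (ξ i).toDual φ :=
  LinearMap.sum_apply (R := K) (R₂ := K) s (fun i => (ξ i).toDual) φ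

lemma homRightMul_apply (M : Type u) [AddCommGroup M] [Module C M] (c : C) (φ : M →ₗ[C] C)
    (m : M) : homRightMul K C M c φ m = φ m * c := rfl

variable (K) in
lemma sum_homRightMul_dualBasis {P : Type u} [AddCommGroup P] [Module C P] {n : ℕ}
    {p : Fin n → P} {φ : Fin n → P →ₗ[C] C} (h : ∀ x, ∑ i, φ i x • p i = x) (ψ : P →ₗ[C] C) :
    ∑ i, homRightMul K C P (ψ (p i)) (φ i) = ψ := by
  ext x
  conv_rhs => rw [← h x, map_sum]
  simp [homRightMul_apply]

/-- The map `M → ν P`, `m ↦ (φ ↦ ℓ(φ(p) m))`, attached to an element `p` of `P` and a linear form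
`ℓ` on `M`. -/
def toNakayama {P M : Type u} [AddCommGroup P] [Module C P] [AddCommGroup M] [Module C M]
    [Module K M] [IsScalarTower K C M] (p : P) (ℓ : Module.Dual K M) :
    M →ₗ[C] NakayamaObj K C P where
  toFun m := show Module.Dual K (P →ₗ[C] C) from
    { toFun := fun φ => ℓ (φ p • m)
      map_add' := fun φ ψ => by rw [LinearMap.add_apply, add_smul, map_add]
      map_smul' := fun a φ => by
        rw [LinearMap.smul_apply, smul_assoc, map_smul, RingHom.id_apply] }
  map_add' m m' := NakayamaObj.ext_toDual fun φ =>
    (congrArg ℓ (smul_add (φ p) m m')).trans (map_add ℓ _ _)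
  map_smul' c m := NakayamaObj.ext_toDual fun φ => congrArg ℓ (mul_smul (φ p) c m).symm

lemma toNakayama_apply {P M : Type u} [AddCommGroup P] [Module C P] [AddCommGroup M] [Module C M]
    [Module K M] [IsScalarTower K C M] (p : P) (ℓ : Module.Dual K M) (m : M) (φ : P →ₗ[C] C) :
    (toNakayama p ℓ m).toDual φ = ℓ (φ p • m) := rfl

variable (K) in
/-- The map `M → Hom_C(DC, ν M)`, `m ↦ (f ↦ (φ ↦ f(φ(m))))`. -/
def nakayamaUnitMap (M : Type u) [AddCommGroup M] [Module C M] :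
    M →ₗ[C] InvNakayamaObj K C (NakayamaObj K C M) where
  toFun m := show DualRegular K C →ₗ[C] NakayamaObj K C M from
    { toFun := fun f => show Module.Dual K (M →ₗ[C] C) from
        { toFun := fun φ => f.toDual (φ m)
          map_add' := fun _ _ => map_add f.toDual _ _
          map_smul' := fun _ _ => map_smul f.toDual _ _ }
      map_add' := fun _ _ => rfl
      map_smul' := fun _ _ => rfl }
  map_add' m m' := LinearMap.ext fun f => NakayamaObj.ext_toDual fun φ =>
    (congrArg f.toDual (map_add φ m m')).trans (map_add f.toDual _ _)
  map_smul' c m := LinearMap.ext fun f => NakayamaObj.ext_toDual fun φ =>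
    congrArg f.toDual (map_smul φ c m)

variable [Module.Finite K C]

variable (K C) in
/-- The natural transformation `M → ν⁻¹ ν M`. -/
noncomputable def nakayamaUnit : 𝟭 (FGModuleCat.{u} C) ⟶ nakayama K C ⋙ invNakayama K C where
  app M := FGModuleCat.ofHom (nakayamaUnitMap K M)
  naturality _ _ _ := FGModuleCat.hom_ext (LinearMap.ext fun _ => LinearMap.ext fun _ => rfl)

lemma exists_dual_ne_zero {c : C} (hc : c ≠ 0) : ∃ f : DualRegular K C, f.toDual c ≠ 0 := by
  by_contra! h
  exact hc ((Module.forall_dual_apply_eq_zero_iff K c).1 h)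

variable [IsNoetherianRing C]

/-- The unit is bijective on projectives. A map `Ψ : DC → ν P` is determined by the elements `c φ`
of `C` with `Ψ(f)(φ) = f(c φ)`, and these define an element of `P` through a dual basis. -/
lemma isIso_nakayamaUnit_app (P : FGModuleCat.{u} C) [Projective P] :
    IsIso ((nakayamaUnit K C).app P) := by
  obtain ⟨n, p, φ, h⟩ := exists_dualBasis P
  refine isIso_of_hom_bijective _ ⟨(injective_iff_map_eq_zero (nakayamaUnitMap K P)).2 ?_, ?_⟩
  · intro x hx
    rw [← h x]
    refine Finset.sum_eq_zero fun i _ => ?_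
    by_contra hi
    obtain ⟨f, hf⟩ := exists_dual_ne_zero (K := K) (c := φ i x) fun h0 => hi (by rw [h0, zero_smul])
    exact hf (congrArg (fun Ψ : DualRegular K C →ₗ[C] NakayamaObj K C P => (Ψ f).toDual (φ i)) hx)
  · intro (Ψ : DualRegular K C →ₗ[C] NakayamaObj K C P)
    let ev (ψ : P →ₗ[C] C) : Module.Dual K (Module.Dual K C) :=
      { toFun := fun f => (Ψ f).toDual ψ
        map_add' := fun f g =>
          congrArg (fun ξ : NakayamaObj K C P => ξ.toDual ψ)
            (map_add Ψ (show DualRegular K C from f) (show DualRegular K C from g))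
        map_smul' := fun a f => by
          have h1 := LinearMap.map_smul_of_tower Ψ a (show DualRegular K C from f)
          exact congrArg (fun ξ : NakayamaObj K C P => ξ.toDual ψ) h1 }
    let c (ψ : P →ₗ[C] C) : C := (Module.evalEquiv K C).symm (ev ψ)
    have hc (ψ : P →ₗ[C] C) (f : DualRegular K C) : f.toDual (c ψ) = (Ψ f).toDual ψ := by
      exact Module.apply_evalEquiv_symm_apply (R := K) (M := C) f.toDual (ev ψ)
    refine ⟨∑ i, c (φ i) • p i, LinearMap.ext fun f => NakayamaObj.ext_toDual fun ψ => ?_⟩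
    change f.toDual (ψ (∑ i, c (φ i) • p i)) = (Ψ f).toDual ψ
    conv_rhs => rw [← sum_homRightMul_dualBasis K h ψ]
    rw [map_sum, map_sum, map_sum]
    refine Finset.sum_congr rfl fun i _ => ?_
    rw [map_smul, smul_eq_mul]
    have h2 := hc (φ i) (ψ (p i) • f)
    rw [map_smul, NakayamaObj.toDual_smul] at h2
    exact h2

/-- `Hom_C(DC, -)` is faithful on morphisms from `ν P`, which is generated by the images of the
maps `DC → ν P`. -/
lemma invNakayama_map_injective (P N : FGModuleCat.{u} C) [Projective P] :
    Function.Injective ((invNakayama K C).map : ((nakayama K C).obj P ⟶ N) → _) := by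
  intro g g' hgg'
  obtain ⟨n, p, φ, h⟩ := exists_dualBasis P
  ext (ξ : NakayamaObj K C P)
  let f (i : Fin n) : DualRegular K C := show Module.Dual K C from
    { toFun := fun x => ξ.toDual (homRightMul K C P x (φ i))
      map_add' := fun x y => by
        rw [← map_add]
        congr 1; ext m; simp [homRightMul_apply, mul_add]
      map_smul' := fun a x => by
        rw [RingHom.id_apply, ← map_smul]
        congr 1; ext m; simp [homRightMul_apply] }
  let η (i : Fin n) : DualRegular K C →ₗ[C] NakayamaObj K C P := nakayamaUnitMap K P (p i)
  have hξ : ξ = ∑ i, η i (f i) := by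
    refine NakayamaObj.ext_toDual fun ψ => ?_
    rw [NakayamaObj.toDual_sum]
    conv_lhs => rw [← sum_homRightMul_dualBasis K h ψ]
    rw [map_sum]
    rfl
  have key (i : Fin n) : g.hom.hom (η i (f i)) = g'.hom.hom (η i (f i)) :=
    congrArg (fun (Θ : (invNakayama K C).obj ((nakayama K C).obj P) ⟶ (invNakayama K C).obj N) =>
      (show DualRegular K C →ₗ[C] N from Θ.hom.hom (nakayamaUnitMap K P (p i))) (f i)) hgg'
  change g.hom.hom ξ = g'.hom.hom ξ
  rw [hξ]
  exact (map_sum g.hom.hom _ _).trans ((Finset.sum_congr rfl fun i _ => key i).trans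
    (map_sum g'.hom.hom _ _).symm)

lemma nakayama_map_bijective (P Q : FGModuleCat.{u} C) [Projective P] [Projective Q] :
    Function.Bijective ((nakayama K C).map : (P ⟶ Q) → _) := by
  have := isIso_nakayamaUnit_app (K := K) P
  have := isIso_nakayamaUnit_app (K := K) Q
  have nat (f : P ⟶ Q) : f ≫ (nakayamaUnit K C).app Q =
      (nakayamaUnit K C).app P ≫ (invNakayama K C).map ((nakayama K C).map f) :=
    (nakayamaUnit K C).naturality f
  constructor
  · intro f g hfg
    rw [← cancel_mono ((nakayamaUnit K C).app Q), nat, nat, hfg]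
  · intro g
    refine ⟨(nakayamaUnit K C).app P ≫ (invNakayama K C).map g ≫
      inv ((nakayamaUnit K C).app Q), invNakayama_map_injective P _ ?_⟩
    rw [← cancel_epi ((nakayamaUnit K C).app P), ← nat]
    simp

end Nakayama

section NakayamaInjective

variable (K : Type u) [Field K] {C : Type u} [Ring C] [Algebra K C]

/-- The `K`-module structure underlying a `C`-module. -/
abbrev restrictModule (M : Type u) [AddCommGroup M] [Module C M] : Module K M :=
  Module.compHom M (algebraMap K C)

lemma isScalarTower_restrictModule (M : Type u) [AddCommGroup M] [Module C M] :
    letI := restrictModule K (C := C) M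
    IsScalarTower K C M :=
  letI := restrictModule K (C := C) M
  ⟨fun a c m => by rw [Algebra.smul_def, mul_smul]; rfl⟩

variable [Module.Finite K C] [IsNoetherianRing C]

/-- `ν P` is injective for `P` projective: with a dual basis `(p i, φ i)`, a map `g : X → ν P` is
the sum of the maps `toNakayama (p i) (ℓ i)` with `ℓ i = g(-)(φ i)`, and each linear form `ℓ i`
extends along `X ↪ Y`. -/
lemma injective_nakayama_obj (P : FGModuleCat.{u} C) [Projective P] :
    Injective ((nakayama K C).obj P) where
  factors {X Y} g f _ := by
    obtain ⟨n, p, φ, h⟩ := exists_dualBasis P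
    let _ := restrictModule K (C := C) X
    let _ := restrictModule K (C := C) Y
    have := isScalarTower_restrictModule K (C := C) X
    have := isScalarTower_restrictModule K (C := C) Y
    let f' : X →ₗ[C] Y := f.hom.hom
    let g' : X →ₗ[C] NakayamaObj K C P := g.hom.hom
    obtain ⟨r, hr⟩ := (f'.restrictScalars K).exists_leftInverse_of_injective
      (LinearMap.ker_eq_bot.2 (hom_injective_of_mono f))
    let ℓ (i : Fin n) : Module.Dual K X :=
      { toFun := fun x => (g' x).toDual (φ i)
        map_add' := fun x y => by rw [map_add]; rfl
        map_smul' := fun a x => by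
          have h1 := LinearMap.map_smul_of_tower g' a x
          exact congrArg (fun ξ : NakayamaObj K C P => ξ.toDual (φ i)) h1 }
    let k : Y →ₗ[C] NakayamaObj K C P := ∑ i, toNakayama (p i) (ℓ i ∘ₗ r)
    refine ⟨FGModuleCat.ofHom k, FGModuleCat.hom_ext (LinearMap.ext fun x => ?_)⟩
    refine NakayamaObj.ext_toDual fun ψ => ?_
    change (k (f' x)).toDual ψ = (g' x).toDual ψ
    rw [LinearMap.sum_apply, NakayamaObj.toDual_sum]
    conv_rhs => rw [← sum_homRightMul_dualBasis K h ψ, map_sum]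
    refine Finset.sum_congr rfl fun i _ => ?_
    rw [toNakayama_apply, LinearMap.comp_apply, ← map_smul]
    have h2 : r (f' (ψ (p i) • x)) = ψ (p i) • x := LinearMap.congr_fun hr _
    rw [h2]
    change (g' (ψ (p i) • x)).toDual (φ i) = _
    rw [map_smul]
    rfl

variable (C) in
lemma isProjectiveEmbedding_nakayama : IsProjectiveEmbedding (nakayama K C) where
  map_bijective P Q _ _ := nakayama_map_bijective P Q
  injective_obj P _ := injective_nakayama_obj K P

omit [IsNoetherianRing C] in
/-- Modules embed in `ν` of a finite power of `P` as soon as `P` has an element on which some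
linear form takes a value acting as the identity. -/
lemma exists_mono_nakayama_pi (M : FGModuleCat.{u} C) (P : Type u) [AddCommGroup P] [Module C P]
    [Module.Finite C P] (p : P) (ψ : P →ₗ[C] C) (hψ : ∀ m : M, ψ p • m = m) :
    ∃ (n : ℕ) (i : M ⟶ (nakayama K C).obj (FGModuleCat.of C (Fin n → P))), Mono i := by
  let _ := restrictModule K (C := C) M
  have := isScalarTower_restrictModule K (C := C) M
  have : Module.Finite K M := finite_of_finite K C M
  let b := Module.finBasis K M
  let i : M →ₗ[C] NakayamaObj K C (Fin (Module.finrank K M) → P) :=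
    ∑ j, toNakayama (Pi.single j p) (b.coord j)
  refine ⟨_, FGModuleCat.ofHom i, mono_of_hom_injective _ ((injective_iff_map_eq_zero i).2 ?_)⟩
  intro m hm
  refine b.ext_elem fun j => ?_
  have h := congrArg (fun ξ : NakayamaObj K C (Fin (Module.finrank K M) → P) =>
    ξ.toDual (ψ ∘ₗ LinearMap.proj j)) hm
  rw [LinearMap.sum_apply, NakayamaObj.toDual_sum, Finset.sum_eq_single j] at h
  · rw [toNakayama_apply] at h
    simp only [LinearMap.comp_apply, LinearMap.proj_apply, Pi.single_eq_same, hψ] at h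
    rw [map_zero]
    exact h
  · intro k _ hk
    rw [toNakayama_apply]
    simp [Pi.single_eq_of_ne hk.symm]
  · simp

omit [IsNoetherianRing C] in
lemma exists_mono_nakayama_free (M : FGModuleCat.{u} C) :
    ∃ (n : ℕ) (i : M ⟶ (nakayama K C).obj (FGModuleCat.of C (Fin n → C))), Mono i :=
  exists_mono_nakayama_pi K M C 1 LinearMap.id fun m => one_smul C m

/-- Every injective module is of the form `ν P` with `P` projective: it is a direct summand of
`ν F` with `F` free, and the corresponding idempotent lifts to `F`. -/
lemma exists_nakayama_iso_of_injective (I : FGModuleCat.{u} C) [Injective I] :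
    ∃ P : FGModuleCat.{u} C, Projective P ∧ Nonempty ((nakayama K C).obj P ≅ I) := by
  obtain ⟨n, i, _⟩ := exists_mono_nakayama_free K I
  have : Projective (FGModuleCat.of C (Fin n → C)) := projective_of_moduleProjective _
  have hir : i ≫ Injective.factorThru (𝟙 I) i = 𝟙 I := Injective.comp_factorThru _ _
  generalize Injective.factorThru (𝟙 I) i = r at hir
  obtain ⟨e, he⟩ := (nakayama_map_bijective (K := K) (FGModuleCat.of C (Fin n → C))
    (FGModuleCat.of C (Fin n → C))).surjective (r ≫ i)
  have hee : e ≫ e = e := by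
    apply (nakayama_map_bijective (K := K) _ _).injective
    rw [Functor.map_comp, he, Category.assoc, reassoc_of% hir]
  obtain ⟨P, s, t, hst, hts⟩ := IsIdempotentComplete.idempotents_split _ e hee
  have hP : Projective P := Retract.projective ⟨s, t, hst⟩
  refine ⟨P, hP, ⟨⟨(nakayama K C).map s ≫ r, i ≫ (nakayama K C).map t, ?_, ?_⟩⟩⟩
  · rw [Category.assoc, ← Category.assoc r, ← he, ← hts, ← (nakayama K C).map_comp,
      ← (nakayama K C).map_comp, Category.assoc, hst, Category.comp_id, hst,
      (nakayama K C).map_id]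
  · rw [Category.assoc, ← Functor.map_comp_assoc, hts, he, Category.assoc, hir, Category.comp_id,
      hir]

end NakayamaInjective

/-! ### Modules annihilated by a summand of the regular module -/

section Annihilated

variable {C : Type u} [Ring C]

/-- The finitely generated modules annihilated by the left ideal `I`. -/
def annihilatedBy (I : Submodule C C) : ObjectProperty (FGModuleCat.{u} C) :=
  fun M => ∀ x ∈ I, ∀ m : M, x • m = 0

lemma annihilatedBy_of_mono [IsNoetherianRing C] {I : Submodule C C} {M N : FGModuleCat.{u} C}
    (f : M ⟶ N) [Mono f] (hN : annihilatedBy I N) : annihilatedBy I M := fun x hx m =>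
  hom_injective_of_mono f (by rw [map_smul, map_zero]; exact hN x hx _)

lemma annihilatedBy_of_epi [IsNoetherianRing C] {I : Submodule C C} {M N : FGModuleCat.{u} C}
    (f : M ⟶ N) [Epi f] (hM : annihilatedBy I M) : annihilatedBy I N := fun x hx n => by
  obtain ⟨m, rfl⟩ := hom_surjective_of_epi f n
  rw [← map_smul, hM x hx m, map_zero]

lemma exists_add_eq_one_of_isCompl {I J : Submodule C C} (h : IsCompl I J) :
    ∃ e ∈ I, ∃ f ∈ J, e + f = 1 ∧ (∀ x ∈ I, x * e = x) ∧ (∀ x ∈ J, x * f = x) := by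
  refine ⟨I.projection J h 1, Submodule.coe_mem _, J.projection I h.symm 1, Submodule.coe_mem _,
    Submodule.projection_add_projection_eq_self h 1, fun x hx => ?_, fun x hx => ?_⟩
  · rw [← smul_eq_mul, ← map_smul, smul_eq_mul, mul_one]
    exact congrArg Subtype.val (Submodule.projectionOnto_apply_left h ⟨x, hx⟩)
  · rw [← smul_eq_mul, ← map_smul, smul_eq_mul, mul_one]
    exact congrArg Subtype.val (Submodule.projectionOnto_apply_left h.symm ⟨x, hx⟩)

lemma moduleProjective_pi (P : Type u) [AddCommGroup P] [Module C P] [Module.Projective C P]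
    (n : ℕ) : Module.Projective C (Fin n → P) :=
  Module.Projective.of_equiv (DFinsupp.linearEquivFunOnFintype (R := C) (M := fun _ : Fin n => P))

lemma moduleProjective_of_isCompl {I J : Submodule C C} (h : IsCompl I J) :
    Module.Projective C I :=
  Module.Projective.of_split I.subtype (I.projectionOnto J h)
    (Submodule.projectionOnto_comp_subtype h)

/-- There are no nonzero maps from `I` to a module annihilated by `I`. -/
lemma hom_eq_zero_of_annihilatedBy {I J : Submodule C C} (h : IsCompl I J) {M : Type u}
    [AddCommGroup M] [Module C M] (hM : ∀ x ∈ I, ∀ m : M, x • m = 0) (f : I →ₗ[C] M) : f = 0 := by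
  obtain ⟨e, he, -, -, -, hI, -⟩ := exists_add_eq_one_of_isCompl h
  ext x
  have : x = (x : C) • (⟨e, he⟩ : I) := Subtype.ext (hI x x.2).symm
  rw [this, map_smul, hM x x.2, LinearMap.zero_apply]

variable {I J : Submodule C C} (h : IsCompl I J) (hJI : ∀ f : J →ₗ[C] I, f = 0)

include hJI in
lemma mul_eq_zero_of_hom_eq_zero {x y : C} (hx : x ∈ J) (hy : y ∈ I) : x * y = 0 :=
  congrArg Subtype.val (LinearMap.congr_fun
    (hJI ((LinearMap.toSpanSingleton C I ⟨y, hy⟩) ∘ₗ J.subtype)) ⟨x, hx⟩)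

include h hJI

/-- If `M` is annihilated by `I`, every map from `M` to `I` vanishes, as `J I = 0`. -/
lemma hom_eq_zero_of_annihilatedBy_compl {M : Type u} [AddCommGroup M] [Module C M]
    (hM : ∀ x ∈ I, ∀ m : M, x • m = 0) (f : M →ₗ[C] I) : f = 0 := by
  obtain ⟨e, he, e', he', hee', -, -⟩ := exists_add_eq_one_of_isCompl h
  ext m
  have hm : m = e' • m := by
    conv_lhs => rw [← one_smul C m, ← hee', add_smul, hM e he, zero_add]
  rw [hm, map_smul]
  exact mul_eq_zero_of_hom_eq_zero hJI he' (f m).2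

omit h hJI in
/-- For `x ∈ I` and `φ : P → C`, the map `φ(-) x` takes values in the left ideal `I`, so it vanishes
if there are no nonzero maps from `P` to `I`. -/
lemma annihilatedBy_nakayama (K : Type u) [Field K] [Algebra K C] [Module.Finite K C]
    (P : FGModuleCat.{u} C) (hP : ∀ f : P →ₗ[C] I, f = 0) :
    annihilatedBy I ((nakayama K C).obj P) := by
  intro x hx (ξ : NakayamaObj K C P)
  refine NakayamaObj.ext_toDual fun φ => ?_
  have : homRightMul K C P x φ = 0 := LinearMap.ext fun r => congrArg Subtype.val
    (LinearMap.congr_fun (hP ((LinearMap.toSpanSingleton C I ⟨x, hx⟩) ∘ₗ φ)) r)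
  change ξ.toDual (homRightMul K C P x φ) = 0
  rw [this, map_zero]

omit hJI in
/-- A module `M` annihilated by `J` is a quotient of a finite power of `I`. -/
lemma exists_epi_of_annihilatedBy [IsNoetherianRing C] (M : FGModuleCat.{u} C)
    (hM : annihilatedBy J M) :
    ∃ (n : ℕ) (π : FGModuleCat.of C (Fin n → I) ⟶ M), Epi π := by
  obtain ⟨e, he, e', he', hee', -, -⟩ := exists_add_eq_one_of_isCompl h
  obtain ⟨n, f, hf⟩ := Module.Finite.exists_fin' C M
  let g : (Fin n → I) →ₗ[C] M := f ∘ₗ LinearMap.pi fun i => I.subtype ∘ₗ LinearMap.proj i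
  refine ⟨n, FGModuleCat.ofHom g, epi_of_hom_surjective _ fun m => ?_⟩
  obtain ⟨c, rfl⟩ := hf m
  refine ⟨fun i => ⟨c i * e, I.smul_mem _ he⟩, ?_⟩
  change f (fun i => c i * e) = f c
  rw [LinearMap.pi_apply_eq_sum_univ f, LinearMap.pi_apply_eq_sum_univ f c]
  refine Finset.sum_congr rfl fun i _ => ?_
  have hfix (m : M) : m = e • m := by
    conv_lhs => rw [← one_smul C m, ← hee', add_smul, hM e' he', add_zero]
  rw [mul_smul, ← hfix]

omit hJI in
/-- A module annihilated by `I` embeds in `ν` of a finite power of `J`. -/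
lemma exists_mono_of_annihilatedBy (K : Type u) [Field K] [Algebra K C] [Module.Finite K C]
    [IsNoetherianRing C] (M : FGModuleCat.{u} C) (hM : annihilatedBy I M) :
    ∃ (n : ℕ) (i : M ⟶ (nakayama K C).obj (FGModuleCat.of C (Fin n → J))), Mono i := by
  obtain ⟨e, he, e', he', hee', -, -⟩ := exists_add_eq_one_of_isCompl h
  refine exists_mono_nakayama_pi K M J ⟨e', he'⟩ J.subtype fun m => ?_
  conv_rhs => rw [← one_smul C m, ← hee', add_smul, hM e he, zero_add]
  rfl

/-- Every module `M` is an extension of a module annihilated by `I` by one annihilated by `J`. -/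
lemma exists_shortExact_annihilatedBy [IsNoetherianRing C] (M : FGModuleCat.{u} C) :
    ∃ S : ShortComplex (FGModuleCat.{u} C), S.ShortExact ∧ annihilatedBy J S.X₁ ∧ S.X₂ = M ∧
      annihilatedBy I S.X₃ := by
  obtain ⟨e, he, e', he', hee', -, -⟩ := exists_add_eq_one_of_isCompl h
  -- the submodule of elements killed by `J` is stable under `C` because `J I = 0`
  let N : Submodule C M :=
    { carrier := {m | ∀ x ∈ J, x • m = 0}
      add_mem' := fun {a b} ha hb x hx => by rw [smul_add, ha x hx, hb x hx, add_zero]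
      zero_mem' := fun x _ => smul_zero x
      smul_mem' := fun c m hm x hx => by
        rw [← one_smul C m, ← hee', add_smul, hm e' he', add_zero, ← mul_smul, ← mul_smul,
          mul_assoc, ← smul_eq_mul c e, mul_eq_zero_of_hom_eq_zero hJI hx (I.smul_mem c he),
          zero_smul] }
  let i : FGModuleCat.of C N ⟶ M := FGModuleCat.ofHom N.subtype
  have : Mono i := mono_of_hom_injective _ N.injective_subtype
  refine ⟨ShortComplex.mk i (cokernel.π i) (cokernel.condition i),
    { exact := ShortComplex.exact_cokernel i }, fun x hx m => Subtype.ext (m.2 x hx), rfl, ?_⟩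
  intro x hx m
  obtain ⟨m, rfl⟩ := hom_surjective_of_epi (cokernel.π i) m
  have hxm : x • m ∈ N := fun y hy => by
    rw [← mul_smul, mul_eq_zero_of_hom_eq_zero hJI hy hx, zero_smul]
  refine (map_smul (cokernel.π i).hom.hom x m).symm.trans ?_
  exact congrArg (fun g : FGModuleCat.of C N ⟶ cokernel i => g.hom.hom ⟨x • m, hxm⟩)
    (cokernel.condition i)

end Annihilated

/-! ### Generation -/

section Generation

open ZeroObject

variable {C : Type u} [Ring C] [IsNoetherianRing C]

lemma GlobalDimensionLE.hasInjectiveDimensionLT {n : ℕ} (h : GlobalDimensionLE C n)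
    (M : FGModuleCat.{u} C) : HasInjectiveDimensionLT M (n + 1) where
  subsingleton' i hi Y := by
    have := h Y
    exact extVanishes_of_hasProjectiveDimensionLT Y M (n + 1) i hi

variable [HasDerivedCategory.{w} (FGModuleCat.{u} C)]

lemma prop_single_pi (V : ObjectProperty (DerivedCategory (FGModuleCat.{u} C))) [V.IsTriangulated]
    [V.IsClosedUnderIsomorphisms] (N : Type u) [AddCommGroup N] [Module C N] [Module.Finite C N]
    (hN : V ((DerivedCategory.singleFunctor _ 0).obj (FGModuleCat.of C N))) (n : ℕ) :
    V ((DerivedCategory.singleFunctor _ 0).obj (FGModuleCat.of C (Fin n → N))) := by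
  induction n with
  | zero =>
    refine V.prop_of_isZero (Functor.map_isZero _ ?_)
    rw [IsZero.iff_id_eq_zero]
    exact FGModuleCat.hom_ext (LinearMap.ext fun x => funext fun i => i.elim0)
  | succ n ih =>
    let f : N →ₗ[C] (Fin (n + 1) → N) := LinearMap.single C (fun _ => N) 0
    let g : (Fin (n + 1) → N) →ₗ[C] (Fin n → N) := LinearMap.funLeft C N Fin.succ
    let r : (Fin (n + 1) → N) →ₗ[C] N := LinearMap.proj 0
    let s : (Fin n → N) →ₗ[C] (Fin (n + 1) → N) :=
      LinearMap.pi (Fin.cons 0 fun i => LinearMap.proj i)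
    let S := ShortComplex.mk (FGModuleCat.ofHom f) (FGModuleCat.ofHom g)
      (FGModuleCat.hom_ext (LinearMap.ext fun x => funext fun i =>
        Pi.single_eq_of_ne (M := fun _ : Fin (n + 1) => N) (Fin.succ_ne_zero i) (x : N)))
    have σ : S.Splitting :=
      { r := FGModuleCat.ofHom r
        s := FGModuleCat.ofHom s
        f_r := FGModuleCat.hom_ext (LinearMap.ext fun x => Pi.single_eq_same
          (M := fun _ : Fin (n + 1) => N) (0 : Fin (n + 1)) (x : N))
        s_g := FGModuleCat.hom_ext (LinearMap.ext fun x => funext fun i => rfl)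
        id := FGModuleCat.hom_ext (LinearMap.ext fun x => funext fun i => by
          change (Pi.single 0 (x 0) : Fin (n + 1) → N) i + s (fun i => x i.succ) i = x i
          refine Fin.cases ?_ (fun i => ?_) i
          · simp [s]
          · simp [s]) }
    exact prop_single_X₂ V σ.shortExact hN ih

lemma prop_single_regular (V : ObjectProperty (DerivedCategory (FGModuleCat.{u} C)))
    [V.IsTriangulated] [V.IsClosedUnderIsomorphisms] {I J : Submodule C C} (h : IsCompl I J)
    (hI : V ((DerivedCategory.singleFunctor _ 0).obj (FGModuleCat.of C I)))
    (hJ : V ((DerivedCategory.singleFunctor _ 0).obj (FGModuleCat.of C J))) :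
    V ((DerivedCategory.singleFunctor _ 0).obj (FGModuleCat.of C C)) := by
  let S := ShortComplex.mk (FGModuleCat.ofHom I.subtype)
    (FGModuleCat.ofHom (J.projectionOnto I h.symm))
    (FGModuleCat.hom_ext (LinearMap.ext fun x => Submodule.projectionOnto_apply_right h.symm x))
  have σ : S.Splitting :=
    { r := FGModuleCat.ofHom (I.projectionOnto J h)
      s := FGModuleCat.ofHom J.subtype
      f_r := FGModuleCat.hom_ext (LinearMap.ext fun x => Submodule.projectionOnto_apply_left h x)
      s_g := FGModuleCat.hom_ext
        (LinearMap.ext fun x => Submodule.projectionOnto_apply_left h.symm x)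
      id := FGModuleCat.hom_ext
        (LinearMap.ext fun x => Submodule.projection_add_projection_eq_self h x) }
  exact prop_single_X₂ V σ.shortExact hI hJ

/-- If `C` has finite global dimension, a thick subcategory containing the regular module contains
all finitely generated modules. -/
lemma prop_single_of_regular (V : ObjectProperty (DerivedCategory (FGModuleCat.{u} C)))
    [V.IsTriangulated] [V.IsClosedUnderIsomorphisms] [V.IsStableUnderRetracts]
    (hC : V ((DerivedCategory.singleFunctor _ 0).obj (FGModuleCat.of C C))) {d : ℕ}
    (hgl : GlobalDimensionLE C d) (M : FGModuleCat.{u} C) :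
    V ((DerivedCategory.singleFunctor _ 0).obj M) := by
  have hcover (M : FGModuleCat.{u} C) :
      ∃ (n : ℕ) (π : FGModuleCat.of C (Fin n → C) ⟶ M), Epi π := by
    obtain ⟨n, f, hf⟩ := Module.Finite.exists_fin' C M
    exact ⟨n, FGModuleCat.ofHom f, epi_of_hom_surjective _ hf⟩
  refine prop_single_of_hasProjectiveDimensionLT V ⊤ (fun P _ _ => ?_) (fun M _ => ?_) d M trivial
    (hgl M)
  · obtain ⟨n, π, _⟩ := hcover P
    let ρ : Retract P (FGModuleCat.of C (Fin n → C)) :=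
      ⟨Projective.factorThru (𝟙 P) π, π, Projective.factorThru_comp _ _⟩
    exact V.prop_of_retract (ρ.map (DerivedCategory.singleFunctor _ 0)) (prop_single_pi V C hC n)
  · obtain ⟨n, π, hπ⟩ := hcover M
    exact ⟨_, π, hπ, projective_of_moduleProjective _, prop_single_pi V C hC n, trivial⟩

variable (K : Type u) [Field K] [Algebra K C] [Module.Finite K C]

/-- Every module is isomorphic in the derived category to `ν R` for a bounded complex of projectives
`R`, by induction on the injective dimension. -/
lemma derivedImage_nakayama_top {d : ℕ} (hgl : GlobalDimensionLE C d) (M : FGModuleCat.{u} C) :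
    derivedImage (nakayama K C) ⊤ ((DerivedCategory.singleFunctor _ 0).obj M) := by
  have : (⊤ : ObjectProperty (DerivedCategory (FGModuleCat.{u} C))).IsTriangulated :=
    { exists_zero := ⟨0, isZero_zero _, trivial⟩
      isStableUnderShiftBy := fun _ => ⟨fun _ _ => trivial⟩
      ext₂' := fun _ _ _ _ => ObjectProperty.le_isoClosure _ _ trivial }
  have := (isProjectiveEmbedding_nakayama K C).isTriangulated_derivedImage ⊤
  refine prop_single_of_hasInjectiveDimensionLT (derivedImage (nakayama K C) ⊤) ⊤
    (fun I _ _ => ?_) (fun M _ => ?_) d M trivial (hgl.hasInjectiveDimensionLT M)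
  · obtain ⟨P, _, ⟨e⟩⟩ := exists_nakayama_iso_of_injective K I
    exact ObjectProperty.prop_of_iso _ ((DerivedCategory.singleFunctor _ 0).mapIso e)
      (derivedImage_single P trivial)
  · obtain ⟨n, i, hi⟩ := exists_mono_nakayama_free K M
    have : Projective (FGModuleCat.of C (Fin n → C)) := projective_of_moduleProjective _
    exact ⟨_, i, hi, injective_nakayama_obj K _, derivedImage_single _ trivial, trivial⟩

/-- If `J I = 0` and `C` has finite global dimension, a thick subcategory `W` containing `J` and a
bounded complex `R` of projectives with `ν R ≅ I` contains all modules. Indeed, the image of `W` under `ν` contains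
`I` and `ν J`, hence the modules annihilated by `J`, which are resolved by summands of powers of
`I`, and the modules annihilated by `I`, which are coresolved by summands of powers of `ν J`. So
it contains all modules, in particular `ν I`, and `W` contains `I`. -/
lemma prop_single_of_isCompl (W : ObjectProperty (DerivedCategory (FGModuleCat.{u} C)))
    [W.IsTriangulated] [W.IsStableUnderRetracts]
    {I J : Submodule C C} (h : IsCompl I J) (hJI : ∀ f : J →ₗ[C] I, f = 0)
    {d : ℕ} (hgl : GlobalDimensionLE C d)
    (hI : derivedImage (nakayama K C) W
      ((DerivedCategory.singleFunctor _ 0).obj (FGModuleCat.of C I)))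
    (hJ : W ((DerivedCategory.singleFunctor _ 0).obj (FGModuleCat.of C J)))
    (M : FGModuleCat.{u} C) : W ((DerivedCategory.singleFunctor _ 0).obj M) := by
  have hν := isProjectiveEmbedding_nakayama K C
  have := hν.isTriangulated_derivedImage W
  have := moduleProjective_of_isCompl h
  have := moduleProjective_of_isCompl h.symm
  have hPI (n : ℕ) : Projective (FGModuleCat.of C (Fin n → I)) :=
    have := moduleProjective_pi (C := C) I n
    projective_of_moduleProjective _
  have hPJ (n : ℕ) : Projective (FGModuleCat.of C (Fin n → J)) :=
    have := moduleProjective_pi (C := C) J n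
    projective_of_moduleProjective _
  have : Projective (FGModuleCat.of C I) := projective_of_moduleProjective _
  let V := derivedImage (nakayama K C) W
  have hVJ (n : ℕ) : V ((DerivedCategory.singleFunctor _ 0).obj
      ((nakayama K C).obj (FGModuleCat.of C (Fin n → J)))) :=
    derivedImage_single _ (prop_single_pi W J hJ n)
  have h₁ (M : FGModuleCat.{u} C) (hM : annihilatedBy J M) :
      V ((DerivedCategory.singleFunctor _ 0).obj M) := by
    refine prop_single_of_hasProjectiveDimensionLT V (annihilatedBy J) (fun P hP _ => ?_)
      (fun M hM => ?_) d M hM (hgl M)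
    · obtain ⟨n, π, _⟩ := exists_epi_of_annihilatedBy h P hP
      let ρ : Retract P (FGModuleCat.of C (Fin n → I)) :=
        ⟨Projective.factorThru (𝟙 P) π, π, Projective.factorThru_comp _ _⟩
      exact hν.derivedImage_of_retract W (ρ.map (DerivedCategory.singleFunctor _ 0))
        (derivedImage_nakayama_top K hgl P) (prop_single_pi V I hI n)
    · obtain ⟨n, π, hπ⟩ := exists_epi_of_annihilatedBy h M hM
      have hJ0 : annihilatedBy J (FGModuleCat.of C (Fin n → I)) := fun x hx m =>
        funext fun i => Subtype.ext (mul_eq_zero_of_hom_eq_zero hJI hx (m i).2)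
      exact ⟨_, π, hπ, hPI n, prop_single_pi V I hI n, annihilatedBy_of_mono (kernel.ι π) hJ0⟩
  have h₃ (M : FGModuleCat.{u} C) (hM : annihilatedBy I M) :
      V ((DerivedCategory.singleFunctor _ 0).obj M) := by
    refine prop_single_of_hasInjectiveDimensionLT V (annihilatedBy I) (fun E hE _ => ?_)
      (fun M hM => ?_) d M hM (hgl.hasInjectiveDimensionLT M)
    · obtain ⟨n, i, _⟩ := exists_mono_of_annihilatedBy h K E hE
      let ρ : Retract E ((nakayama K C).obj (FGModuleCat.of C (Fin n → J))) :=
        ⟨i, Injective.factorThru (𝟙 E) i, Injective.comp_factorThru _ _⟩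
      exact hν.derivedImage_of_retract W (ρ.map (DerivedCategory.singleFunctor _ 0))
        (derivedImage_nakayama_top K hgl E) (hVJ n)
    · obtain ⟨n, i, hi⟩ := exists_mono_of_annihilatedBy h K M hM
      have hI0 := annihilatedBy_nakayama (I := I) K (FGModuleCat.of C (Fin n → J)) fun f =>
        LinearMap.pi_ext' fun k => (hJI _).trans (LinearMap.zero_comp _).symm
      exact ⟨_, i, hi, hν.injective_obj _, hVJ n, annihilatedBy_of_epi (cokernel.π i) hI0⟩
  have hV (M : FGModuleCat.{u} C) : V ((DerivedCategory.singleFunctor _ 0).obj M) := by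
    obtain ⟨S, hS, hS₁, rfl, hS₃⟩ := exists_shortExact_annihilatedBy h hJI M
    exact prop_single_X₂ V hS (h₁ _ hS₁) (h₃ _ hS₃)
  have hWI : W ((DerivedCategory.singleFunctor _ 0).obj (FGModuleCat.of C I)) := by
    refine hν.of_derivedImage W (isBoundedProjective_single (FGModuleCat.of C I) 0) ?_
    exact ObjectProperty.prop_of_iso _ (DerivedCategory.Q.mapIso
      ((HomologicalComplex.singleMapHomologicalComplex (nakayama K C) (.up ℤ) 0).app
        (FGModuleCat.of C I)).symm) (hV ((nakayama K C).obj (FGModuleCat.of C I)))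
  exact prop_single_of_regular W (prop_single_regular W h hWI hJ) hgl M

end Generation

/-! ### The object `F M` -/

section FObject

variable (K : Type u) [Field K] (C : Type u) [Ring C] [Algebra K C] [Module.Finite K C]
  [IsNoetherianRing C]

lemma nonempty_invNakayama_nakayama_iso {R : CochainComplex (FGModuleCat.{u} C) ℤ}
    (hR : IsBoundedProjective R) :
    Nonempty (((invNakayama K C).mapHomologicalComplex (.up ℤ)).obj
      (((nakayama K C).mapHomologicalComplex (.up ℤ)).obj R) ≅ R) := by
  have := hR.projective
  let e (i : ℤ) : R.X i ≅ (invNakayama K C).obj ((nakayama K C).obj (R.X i)) :=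
    have := isIso_nakayamaUnit_app (K := K) (R.X i)
    asIso (f := (nakayamaUnit K C).app (R.X i))
  exact ⟨(HomologicalComplex.Hom.isoOfComponents e
    fun i j _ => ((nakayamaUnit K C).naturality (R.d i j)).symm).symm⟩

variable [HasDerivedCategory.{w} (FGModuleCat.{u} C)]

/-- `ν⁻¹` is computed by applying `Hom_C(DC, -)` to a complex of injectives. -/
lemma nonempty_derivedInvNakayama_iso {R : CochainComplex (FGModuleCat.{u} C) ℤ}
    (hR : IsBoundedProjective R) (X : DerivedCategory.Plus (FGModuleCat.{u} C))
    (e : DerivedCategory.Plus.ι.obj X ≅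
      DerivedCategory.Q.obj (((nakayama K C).mapHomologicalComplex (.up ℤ)).obj R)) :
    Nonempty (DerivedCategory.Plus.ι.obj ((derivedInvNakayama K C).obj X) ≅
      DerivedCategory.Q.obj R) := by
  have := enoughInjectives K C
  obtain ⟨a, _, _, _⟩ := hR.bounded
  let L := ((nakayama K C).mapHomologicalComplex (.up ℤ)).obj R
  have hL : CochainComplex.plus _ L :=
    ⟨a, inferInstanceAs (CochainComplex.IsStrictlyGE
      (((nakayama K C).mapHomologicalComplex (.up ℤ)).obj R) a)⟩
  let L' : HomotopyCategory.Plus (FGModuleCat.{u} C) :=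
    (HomotopyCategory.Plus.quotient _).obj ⟨L, hL⟩
  have (i : ℤ) : Injective (L'.obj.as.X i) :=
    have := hR.projective i
    injective_nakayama_obj K (R.X i)
  have hu : IsIso ((invNakayama K C).rightDerivedFunctorPlusUnit.app L') := inferInstance
  let e₁ : X ≅ DerivedCategory.Plus.Qh.obj L' :=
    DerivedCategory.Plus.ι.preimageIso
      (e ≪≫ (DerivedCategory.quotientCompQhIso _).symm.app L)
  obtain ⟨e₂⟩ := nonempty_invNakayama_nakayama_iso K C hR
  refine ⟨DerivedCategory.Plus.ι.mapIso ((derivedInvNakayama K C).mapIso e₁ ≪≫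
    (asIso ((invNakayama K C).rightDerivedFunctorPlusUnit.app L')).symm) ≪≫ ?_ ≪≫
    DerivedCategory.Q.mapIso e₂⟩
  exact (DerivedCategory.quotientCompQhIso _).app
    (((invNakayama K C).mapHomologicalComplex (.up ℤ)).obj L)

/-- `F = ν⁻¹⟦2⟧` takes a module isomorphic to `ν R` to `R⟦2⟧`. -/
lemma nonempty_FObj_iso {R : CochainComplex (FGModuleCat.{u} C) ℤ}
    (hR : IsBoundedProjective R) (M : FGModuleCat.{u} C)
    (e : (DerivedCategory.singleFunctor _ 0).obj M ≅
      DerivedCategory.Q.obj (((nakayama K C).mapHomologicalComplex (.up ℤ)).obj R)) :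
    Nonempty (FObj K C M ≅ DerivedCategory.Q.obj (R⟦(2 : ℤ)⟧)) := by
  obtain ⟨e'⟩ := nonempty_derivedInvNakayama_iso K C hR
    ((DerivedCategory.Plus.singleFunctor _ 0).obj M) e
  let Y := (derivedInvNakayama K C).obj ((DerivedCategory.Plus.singleFunctor _ 0).obj M)
  let e₁ : FObj K C M ≅ DerivedCategory.Plus.ι.obj (Y⟦(2 : ℤ)⟧) :=
    DerivedCategory.Plus.ι.mapIso ((shiftFunctorAdd' _ (1 : ℤ) 1 2 rfl).symm.app Y)
  exact ⟨e₁ ≪≫ (DerivedCategory.Plus.ι.commShiftIso (2 : ℤ)).app Y ≪≫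
    (shiftFunctor _ (2 : ℤ)).mapIso e' ≪≫ (DerivedCategory.Q.commShiftIso (2 : ℤ)).symm.app R⟩

end FObject

/-! ### Morphisms between shifts -/

section Shifts

lemma hom_eq_zero_of_iso {D : Type*} [Category* D] [HasZeroMorphisms D] {X X' Y Y' : D}
    (eX : X' ≅ X) (eY : Y' ≅ Y) (h : ∀ f : X ⟶ Y, f = 0) (f : X' ⟶ Y') : f = 0 := by
  rw [← eX.hom_inv_id_assoc f, ← cancel_mono eY.hom, Category.assoc, Category.assoc,
    h (eX.inv ≫ f ≫ eY.hom), comp_zero, zero_comp]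

variable {D : Type*} [Category* D] [Preadditive D] [HasShift D ℤ]
  [∀ n : ℤ, (shiftFunctor D n).Additive]

lemma hom_shift_eq_zero {X Y : D} {a b m n : ℤ} (hm : m + a = b + n)
    (h : ∀ f : X ⟶ Y⟦m⟧, f = 0) (f : X⟦a⟧ ⟶ Y⟦b⟧⟦n⟧) : f = 0 := by
  refine hom_eq_zero_of_iso (Iso.refl _) ((shiftFunctorAdd' D b n _ rfl).symm.app Y ≪≫
    (shiftFunctorAdd' D m a (b + n) hm).app Y) (fun g => ?_) f
  obtain ⟨g, rfl⟩ := (shiftFunctor D a).map_surjective g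
  rw [h g, Functor.map_zero]

lemma hom_biprod_shift_eq_zero [HasBinaryBiproducts D] {X Y Z : D} {n : ℤ}
    (hX : ∀ f : Z ⟶ X⟦n⟧, f = 0) (hY : ∀ f : Z ⟶ Y⟦n⟧, f = 0) (f : Z ⟶ (X ⊞ Y)⟦n⟧) : f = 0 := by
  have h : f = f ≫ (𝟙 (X ⊞ Y))⟦n⟧' := by simp
  rw [h, ← biprod.total, Functor.map_add, Functor.map_comp, Functor.map_comp,
    Preadditive.comp_add, ← Category.assoc, ← Category.assoc, hX (f ≫ biprod.fst⟦n⟧'),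
    hY (f ≫ biprod.snd⟦n⟧'), zero_comp, zero_comp, add_zero]

end Shifts

/-! ### Sums and shifts of perfect complexes -/

section

variable {A : Type*} [Category* A] [Abelian A]

lemma IsBoundedProjective.biprod {R S : CochainComplex A ℤ} (hR : IsBoundedProjective R)
    (hS : IsBoundedProjective S) : IsBoundedProjective (R ⊞ S) where
  bounded := by
    obtain ⟨a, b, _, _⟩ := hR.bounded
    obtain ⟨a', b', _, _⟩ := hS.bounded
    refine ⟨min a a', max b b', ?_, ?_⟩
    · rw [CochainComplex.isStrictlyGE_iff]
      intro i hi
      simp at hi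
      exact IsZero.of_iso ((biprod_isZero_iff _ _).2 ⟨R.isZero_of_isStrictlyGE a _ (by lia),
        S.isZero_of_isStrictlyGE a' _ (by lia)⟩) (HomologicalComplex.biprodXIso R S i)
    · rw [CochainComplex.isStrictlyLE_iff]
      intro i hi
      simp at hi
      exact IsZero.of_iso ((biprod_isZero_iff _ _).2 ⟨R.isZero_of_isStrictlyLE b _ (by lia),
        S.isZero_of_isStrictlyLE b' _ (by lia)⟩) (HomologicalComplex.biprodXIso R S i)
  projective i := by
    have := hR.projective i
    have := hS.projective i
    exact Projective.of_iso (HomologicalComplex.biprodXIso R S i).symm inferInstance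

variable [HasDerivedCategory.{w} A]

lemma IsPerfect.biprod {X Y : DerivedCategory A} (hX : IsPerfect X) (hY : IsPerfect Y) :
    IsPerfect (X ⊞ Y) := by
  obtain ⟨R, hR, ⟨e⟩⟩ := hX
  obtain ⟨S, hS, ⟨e'⟩⟩ := hY
  have := preservesBinaryBiproduct_of_preservesBiproduct (DerivedCategory.Q (C := A)) R S
  exact ⟨R ⊞ S, hR.biprod hS, ⟨biprod.mapIso e e' ≪≫ (DerivedCategory.Q.mapBiprod R S).symm⟩⟩

/-- Vanishing of morphisms between bounded complexes of projectives `R` and `S` whose images under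
a projective embedding are shifts of objects of the abelian category. -/
lemma IsProjectiveEmbedding.hom_shift_eq_zero {ν : A ⥤ A} [ν.Additive]
    (hν : IsProjectiveEmbedding ν) {R S : CochainComplex A ℤ} (hR : IsBoundedProjective R)
    (hS : IsBoundedProjective S) {M N : A} {a b m n : ℤ} (hm : m + a = b + n)
    (eR : DerivedCategory.Q.obj ((ν.mapHomologicalComplex (.up ℤ)).obj R) ≅
      ((DerivedCategory.singleFunctor A 0).obj M)⟦a⟧)
    (eS : DerivedCategory.Q.obj ((ν.mapHomologicalComplex (.up ℤ)).obj S) ≅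
      ((DerivedCategory.singleFunctor A 0).obj N)⟦b⟧)
    (h : ∀ f : (DerivedCategory.singleFunctor A 0).obj M ⟶
      ((DerivedCategory.singleFunctor A 0).obj N)⟦m⟧, f = 0)
    (f : DerivedCategory.Q.obj R ⟶ (DerivedCategory.Q.obj S)⟦n⟧) : f = 0 := by
  obtain ⟨e⟩ := nonempty_Q_map_shift_iso (ν := ν) S n
  refine hom_eq_zero_of_iso (Iso.refl _) ((DerivedCategory.Q.commShiftIso n).symm.app S)
    (hν.eq_zero_of_forall_eq_zero hR (hS.shift n) ?_) f
  exact hom_eq_zero_of_iso eR (e ≪≫ (shiftFunctor _ n).mapIso eS)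
    (TwoAPR.hom_shift_eq_zero hm h)

end

end TwoAPR

theorem mainTheorem5
    (K : Type u) [Field K] (C : Type u) [Ring C] [Algebra K C] [Module.Finite K C]
    [IsNoetherianRing C]
    [HasDerivedCategory.{w} (FGModuleCat.{u} C)]
    (hgl : TwoAPR.GlobalDimensionLE C 2)
    (C₀ CR : Submodule C C) (hC : IsCompl C₀ CR)
    (hHom : ∀ f : CR →ₗ[C] C₀, f = 0)
    (hExt : TwoAPR.ExtVanishes ((TwoAPR.nakayama K C).obj (FGModuleCat.of C CR))
      (FGModuleCat.of C C₀) 1) :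
    (∀ X : DerivedCategory (FGModuleCat.{u} C),
      TwoAPR.IsDerivedNakayama K C X
          (((DerivedCategory.singleFunctor _ 0).obj (FGModuleCat.of C C₀))⟦(2 : ℤ)⟧) ↔
        Nonempty (X ≅ TwoAPR.FObj K C (FGModuleCat.of C C₀))) ∧
    TwoAPR.IsTiltingComplex
      (TwoAPR.FObj K C (FGModuleCat.of C C₀) ⊞
        (DerivedCategory.singleFunctor _ 0).obj (FGModuleCat.of C CR)) := by
  open TwoAPR in
  have hν := isProjectiveEmbedding_nakayama K C
  have := moduleProjective_of_isCompl hC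
  have := moduleProjective_of_isCompl hC.symm
  have : Projective (FGModuleCat.of C C₀) := projective_of_moduleProjective _
  have : Projective (FGModuleCat.of C CR) := projective_of_moduleProjective _
  -- `R` is the complex `ν⁻¹ C₀`, so that `F C₀` is `R⟦2⟧`
  obtain ⟨R, hR, -, ⟨e₀⟩⟩ := derivedImage_nakayama_top K hgl (FGModuleCat.of C C₀)
  obtain ⟨eF⟩ := nonempty_FObj_iso K C hR (FGModuleCat.of C C₀) e₀
  obtain ⟨e₂⟩ := nonempty_Q_map_shift_iso (ν := nakayama K C) R 2
  -- `ν` takes `R⟦2⟧` to `C₀⟦2⟧`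
  have e₃ := e₂ ≪≫ (shiftFunctor _ (2 : ℤ)).mapIso e₀.symm
  have hSR := isBoundedProjective_single (FGModuleCat.of C CR) 0
  have eR : DerivedCategory.Q.obj (((nakayama K C).mapHomologicalComplex (.up ℤ)).obj
      ((HomologicalComplex.single _ (.up ℤ) 0).obj (FGModuleCat.of C CR))) ≅
      ((DerivedCategory.singleFunctor _ 0).obj ((nakayama K C).obj (FGModuleCat.of C CR)))⟦(0 : ℤ)⟧ :=
    DerivedCategory.Q.mapIso ((HomologicalComplex.singleMapHomologicalComplex (nakayama K C)
      (.up ℤ) 0).app (FGModuleCat.of C CR)) ≪≫ (shiftFunctorZero _ ℤ).symm.app _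
  have hann := annihilatedBy_nakayama K (FGModuleCat.of C CR) hHom
  refine ⟨fun X => ⟨?_, ?_⟩, ?_, fun n hn => ?_, fun X hX => ?_⟩
  · rintro ⟨P, hP, ⟨eX⟩, ⟨eY⟩⟩
    obtain ⟨e⟩ := hν.nonempty_iso hP (hR.shift 2) (eY.symm ≪≫ e₃.symm)
    exact ⟨eX ≪≫ e ≪≫ eF.symm⟩
  · rintro ⟨e⟩
    exact ⟨_, hR.shift 2, ⟨e ≪≫ eF⟩, ⟨e₃.symm⟩⟩
  · exact IsPerfect.biprod ⟨_, hR.shift 2, ⟨eF⟩⟩ ⟨_, hSR, ⟨Iso.refl _⟩⟩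
  · have h₀₀ : ∀ f : FObj K C (FGModuleCat.of C C₀) ⟶ (FObj K C (FGModuleCat.of C C₀))⟦n⟧, f = 0 :=
      hom_eq_zero_of_iso eF ((shiftFunctor _ n).mapIso eF)
        (hν.hom_shift_eq_zero (hR.shift 2) (hR.shift 2) (add_comm n 2) e₃ e₃
          (shiftedHom_single_eq_zero_of_projective _ _ n fun h => absurd h hn))
    have h₀R : ∀ f : FObj K C (FGModuleCat.of C C₀) ⟶
        ((DerivedCategory.singleFunctor _ 0).obj (FGModuleCat.of C CR))⟦n⟧, f = 0 :=
      hom_eq_zero_of_iso eF (Iso.refl _)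
        (hν.hom_shift_eq_zero (m := n - 2) (hR.shift 2) hSR (by lia) e₃ eR
          (shiftedHom_single_eq_zero_of_projective _ _ _ fun _ f =>
            FGModuleCat.hom_ext (hom_eq_zero_of_annihilatedBy hC hann f.hom.hom)))
    have hR₀ : ∀ f : (DerivedCategory.singleFunctor _ 0).obj (FGModuleCat.of C CR) ⟶
        (FObj K C (FGModuleCat.of C C₀))⟦n⟧, f = 0 := by
      refine hom_eq_zero_of_iso (Iso.refl _) ((shiftFunctor _ n).mapIso eF)
        (hν.hom_shift_eq_zero (m := n + 2) hSR (hR.shift 2) (by lia) eR e₃ ?_)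
      -- degree `2` does not occur since `n ≠ 0`
      rcases lt_or_ge (n + 2) 0 with h | h
      · exact shiftedHom_single_eq_zero_of_neg _ _ _ h
      · obtain ⟨k, hk⟩ := Int.eq_ofNat_of_zero_le h
        rw [hk]
        refine shiftedHom_single_eq_zero_of_ext _ _ k ?_
        obtain rfl | rfl | hk' : k = 0 ∨ k = 1 ∨ 3 ≤ k := by lia
        · exact extVanishes_zero _ _ fun f =>
            FGModuleCat.hom_ext (hom_eq_zero_of_annihilatedBy_compl hC hHom hann f.hom.hom)
        · exact hExt
        · have := hgl ((nakayama K C).obj (FGModuleCat.of C CR))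
          exact extVanishes_of_hasProjectiveDimensionLT _ _ 3 k hk'
    have hRR : ∀ f : (DerivedCategory.singleFunctor _ 0).obj (FGModuleCat.of C CR) ⟶
        ((DerivedCategory.singleFunctor _ 0).obj (FGModuleCat.of C CR))⟦n⟧, f = 0 :=
      shiftedHom_single_eq_zero_of_projective _ _ n fun h => absurd h hn
    intro f
    refine biprod.hom_ext' _ _ ?_ ?_
    · rw [comp_zero]
      exact hom_biprod_shift_eq_zero h₀₀ h₀R _
    · rw [comp_zero]
      exact hom_biprod_shift_eq_zero hR₀ hRR _
  · let T := FObj K C (FGModuleCat.of C C₀) ⊞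
      (DerivedCategory.singleFunctor _ 0).obj (FGModuleCat.of C CR)
    let W := (ObjectProperty.singleton T).triangEnvelope
    have hT : W T := ObjectProperty.le_triangEnvelope _ _ (by simp)
    have hWF : W (FObj K C (FGModuleCat.of C C₀)) :=
      W.prop_of_retract ⟨biprod.inl, biprod.fst, biprod.inl_fst⟩ hT
    have hWR : W ((DerivedCategory.singleFunctor _ 0).obj (FGModuleCat.of C CR)) :=
      W.prop_of_retract ⟨biprod.inr, biprod.snd, biprod.inr_snd⟩ hT
    have hW₀ : W (DerivedCategory.Q.obj R) :=
      W.prop_of_iso ((shiftFunctor _ (-2 : ℤ)).mapIso (eF ≪≫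
        (DerivedCategory.Q.commShiftIso (2 : ℤ)).app R) ≪≫
        (shiftEquiv _ (2 : ℤ)).unitIso.symm.app _) (W.le_shift (-2 : ℤ) _ hWF)
    exact prop_of_isPerfect W
      (prop_single_of_isCompl K W hC hHom hgl ⟨R, hR, hW₀, ⟨e₀⟩⟩ hWR) X hX
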